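/- Let $\mu$ be a finite positive Borel measure on $\mathbb{R}$ with infinite support and finite moments of all orders, supported on an interval $I$ with $c=\inf I\in\mathbb{R}$. Let $r\ge 0$, let $M_0,\dots,M_r>0$, and let $\{q_n\}_{n\ge 0}$ be the orthonormal polynomials (with $\deg q_n=n$) for the discrete Sobolev inner product $$\langle p,q\rangle=\int p\,q\,d\mu+\sum_{i=0}^{r}M_i\,p^{(i)}(c)\,q^{(i)}(c).$$ For $j=0,\dots,r+1$ let $\{p_n^{[2j]}\}_{n\ge 0}$ be the orthonormal polynomials, with positive leading coefficients, for the measure $(x-c)^{2j}\,d\mu(x)$. Let $J_\lambda$ denote the Bessel function of the first kind of order $\lambda$. Suppose that for all $j=0,\dots,r+1$ $$\lim_{n\to\infty}(-1)^n\,\frac{a_n^{1/2}}{b_n^{j}}\;p_n^{[2j]}\!\left(c+\frac{z^2}{b_n}\right)=z^{-(\nu+2j)}J_{\nu+2j}(2z)$$ uniformly on compact subsets of $\mathbb{C}$ (the right-hand side being the entire function $\sum_{m\ge 0}\frac{(-1)^m z^{2m}}{m!\,\Gamma(m+\nu+2j+1)}$), where $\nu>-1$ and $a_n^{-1/2}/(A\,n^{a})\to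 1$, $b_n/(B\,n^{b})\to 1$ with constants $A,B,b>0$ and $a\in\mathbb{R}$ such that $2a+1=b(\nu+1)$. For each $n$ let $\xi_{1,n},\dots,\xi_{n,n}$ be the zeros of $q_n$ in $\mathbb{C}$, repeated according to multiplicity and listed by nondecreasing real part. Then $J_{\nu+2r+2}$ has infinitely many positive zeros; writing $j_k^{\nu+2r+2}$ for the $k$th positive zero of $J_{\nu+2r+2}$, we have $$\lim_{n\to\infty}b_n(\xi_{k,n}-c)=0\quad(1\le k\le r+1),\qquad \lim_{n\to\infty}b_n(\xi_{k,n}-c)=\left(\frac{j_{k-r-1}^{\nu+2r+2}}{2}\right)^{2}\quad(k\ge r+2).$$ So exactly $r+1$ zeros of $q_n$ are accelerated towards the hard edge $c$. -/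

import Mathlib

open MeasureTheory Filter Topology Polynomial

noncomputable section

namespace SobolevOP

/-- The bilinear form `∫ p q dμ` on real polynomials. -/
def l2Form (μ : Measure ℝ) (p q : ℝ[X]) : ℝ :=
  ∫ x, p.eval x * q.eval x ∂μ

/-- The discrete Sobolev form
`⟨p, q⟩ = ∫ p q dμ + ∑_{i=0}^{r} M_i p^{(i)}(c) q^{(i)}(c)`. -/
def sobolevForm (μ : Measure ℝ) (c : ℝ) (r : ℕ) (M : ℕ → ℝ) (p q : ℝ[X]) : ℝ :=
  l2Form μ p q +
    ∑ i ∈ Finset.range (r + 1),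
      M i * (derivative^[i] p).eval c * (derivative^[i] q).eval c

/-- The Christoffel perturbation `dμ_m(x) = (x - c)^m dμ(x)`. -/
def christoffel (μ : Measure ℝ) (c : ℝ) (m : ℕ) : Measure ℝ :=
  μ.withDensity fun x => ENNReal.ofReal ((x - c) ^ m)

/-- `p` is the sequence of orthonormal polynomials of the form `B`, normalized as usual by
positive leading coefficients. -/
structure IsOrthonormalPolynomials (B : ℝ[X] → ℝ[X] → ℝ) (p : ℕ → ℝ[X]) : Prop where
  natDegree_eq : ∀ n, (p n).natDegree = n
  leadingCoeff_pos : ∀ n, 0 < (p n).leadingCoeff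
  orthonormal : ∀ m n, B (p m) (p n) = if m = n then 1 else 0

/-- The relation `x_n ≅ y_n`, that is, `x_n / y_n → 1`. -/
def AsympEq (x y : ℕ → ℝ) : Prop :=
  Tendsto (fun n => x n / y n) atTop (𝓝 1)

/-- The Bessel function of the first kind,
`J_ν(z) = ∑ (-1)^n / (n! Γ(n + ν + 1)) (z / 2)^(2 n + ν)`. -/
def besselJ (ν : ℝ) (z : ℂ) : ℂ :=
  ∑' n : ℕ, (-1) ^ n / ((n.factorial : ℂ) * Complex.Gamma ((n : ℂ) + (ν : ℂ) + 1)) *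
    (z / 2) ^ (2 * (n : ℂ) + (ν : ℂ))

/-- The entire function `z^{-ν} J_ν(2 z) = ∑ (-1)^n / (n! Γ(n + ν + 1)) z^(2 n)`; the series also
gives the value at the removable singularity `z = 0`. -/
def besselEntire (ν : ℝ) (z : ℂ) : ℂ :=
  ∑' n : ℕ, (-1) ^ n / ((n.factorial : ℂ) * Complex.Gamma ((n : ℂ) + (ν : ℂ) + 1)) *
    z ^ (2 * n)

theorem besselEntire_eq (ν : ℝ) {z : ℂ} (hz : z ≠ 0) :
    besselEntire ν z = z ^ (-(ν : ℂ)) * besselJ ν (2 * z) := by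
  unfold besselEntire besselJ
  rw [← tsum_mul_left]
  refine tsum_congr fun n => ?_
  have h1 : 2 * z / 2 = z := by ring
  have h2 : z ^ (2 * (n : ℂ) + (ν : ℂ)) = z ^ (2 * n) * z ^ (ν : ℂ) := by
    rw [Complex.cpow_add _ _ hz, ← Complex.cpow_natCast z (2 * n)]
    push_cast
    rfl
  have h3 : z ^ (-(ν : ℂ)) * z ^ (ν : ℂ) = 1 := by
    rw [← Complex.cpow_add _ _ hz]
    simp
  rw [h1, h2]
  linear_combination
    -((-1) ^ n / ((n.factorial : ℂ) * Complex.Gamma ((n : ℂ) + (ν : ℂ) + 1)) * z ^ (2 * n)) * h3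

/-- `x` is the `k`th positive zero of `J_ν` (`k = 1, 2, …`): it is a positive zero, and together
with it there are exactly `k` zeros in `(0, x]`. -/
def IsKthPositiveBesselZero (ν : ℝ) (k : ℕ) (x : ℝ) : Prop :=
  0 < x ∧ besselJ ν (x : ℂ) = 0 ∧
    {y : ℝ | 0 < y ∧ y ≤ x ∧ besselJ ν (y : ℂ) = 0}.encard = k

/-- `ξ 1, …, ξ n` are the complex zeros of the polynomial `q` of degree `n`, repeated according to
multiplicity and listed by nondecreasing real part (in increasing order if they are real and
simple). Values of `ξ` outside `{1, …, n}` are irrelevant. -/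
def IsOrderedZeros (q : ℝ[X]) (n : ℕ) (ξ : ℕ → ℂ) : Prop :=
  (q.map (algebraMap ℝ ℂ)).roots = (Finset.Icc 1 n).val.map ξ ∧
    MonotoneOn (fun k => (ξ k).re) (Set.Icc 1 n)

end SobolevOP

end

/-! Translating `c` to `0` replaces the measure by a functional `L` on polynomials, nonnegative on
polynomials that are nonnegative on `[0, ∞)`. Write `P j n` for the orthonormal polynomials of `x^(2
j) dL`, `Q n` for the Sobolev ones, and `R n` for `Q n` rescaled to have the leading coefficient of
`P 0 n`. The variable is `w = z ^ 2`, so that the Mehler–Heine limits become the entire functions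
`phi (ν + 2 j)`.

Three facts carry the proof. (1) The Taylor coefficients of `R n` of order at most `r` solve a
linear system built from sums of products of coefficients of the `P 0 k`. After scaling by powers of
`n`, its matrix tends to a Cauchy matrix, which is invertible; hence these coefficients are
negligible compared with those of `P 0 n` (`tendsto_scaled_coeff_zero`). (2) Since `R n` is
`L`-orthogonal to all `X^(r+1) h` with `deg h < n - r - 1`, it is a combination of the `X^j P j (n -
j)` with `j ≤ r + 1` (`exists_eq_sum_X_pow_mul`). By (1) the coefficients with `j ≤ r` tend to `0`,
while comparison of leading coefficients keeps the last one at least `1/2` in absolute value. So, up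
to constant factors, `Q n (w / β n)` tends locally uniformly to `w^(r+1) phi (ν + 2 r + 2) w`, up to
sign (`exists_contConv_sobolev`): the factor `w^(r+1)` accounts for the accelerated zeros, and `phi`
for the Bessel zeros. (3) Hurwitz's theorem alone does not control the order of the zeros by real
part, because zeros of small real part might escape to infinity. The ratios `t P (j+1) n / P j
(n+1)` have partial fractions with nonnegative coefficients and positive poles, so in the sector `Re
t ≤ |Im t|` the last term of the combination dominates all the others
(`norm_orthonormal_le_sector`), and there are no zeros there outside a small disc
(`eventually_sobolev_ne_zero`).

The ordered zeros are then found one at a time, dividing each out of both the sequence and the limit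
(`tendsto_ordered_zeros`). That the zeros of the limiting `phi` are positive reals also follows from
Hurwitz, as limits of zeros of orthogonal polynomials. -/

namespace SobolevOP

/-! ### Locally uniform convergence of entire functions, their zeros and coefficients -/

/-- Continuous convergence of a sequence of functions on `ℂ`; for a continuous limit this is
locally uniform convergence. -/
def ContConv (F : ℕ → ℂ → ℂ) (f : ℂ → ℂ) : Prop :=
  ∀ x, Tendsto (fun y : ℕ × ℂ => F y.1 y.2) (atTop ×ˢ 𝓝 x) (𝓝 (f x))

theorem contConv_iff_tendstoLocallyUniformly {F : ℕ → ℂ → ℂ} {f : ℂ → ℂ} (hf : Continuous f) :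
    ContConv F f ↔ TendstoLocallyUniformly F f atTop := by
  rw [tendstoLocallyUniformly_iff_forall_tendsto]
  refine forall_congr' fun x => ?_
  have hfx : Tendsto (fun y : ℕ × ℂ => f y.2) (atTop ×ˢ 𝓝 x) (𝓝 (f x)) :=
    (hf.tendsto x).comp tendsto_snd
  constructor
  · intro h
    rw [tendsto_uniformity_iff_dist_tendsto_zero]
    simpa using hfx.dist h
  · intro h
    rw [tendsto_uniformity_iff_dist_tendsto_zero] at h
    rw [tendsto_iff_dist_tendsto_zero]
    have h2 := (tendsto_iff_dist_tendsto_zero.1 hfx)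
    refine squeeze_zero (fun _ => dist_nonneg) (fun y => ?_) (by simpa using h.add h2)
    rw [dist_comm (f y.2) (F y.1 y.2)]
    exact dist_triangle _ _ _

theorem ContConv.tendsto {F : ℕ → ℂ → ℂ} {f : ℂ → ℂ} (h : ContConv F f) {u : ℕ → ℂ} {x : ℂ}
    (hu : Tendsto u atTop (𝓝 x)) : Tendsto (fun n => F n (u n)) atTop (𝓝 (f x)) :=
  (h x).comp (tendsto_id.prodMk hu)

theorem ContConv.congr {F G : ℕ → ℂ → ℂ} {f : ℂ → ℂ} (h : ContConv F f)
    (hFG : ∀ᶠ n in atTop, ∀ w, F n w = G n w) : ContConv G f := fun x =>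
  (h x).congr' <| by
    filter_upwards [hFG.prod_inl (𝓝 x)] with y hy using hy y.2

theorem ContConv.tendstoUniformlyOn {F : ℕ → ℂ → ℂ} {f : ℂ → ℂ} (h : ContConv F f)
    (hf : Continuous f) {K : Set ℂ} (hK : IsCompact K) : TendstoUniformlyOn F f atTop K :=
  (tendstoLocallyUniformlyOn_iff_tendstoUniformlyOn_of_compact hK).1
    ((contConv_iff_tendstoLocallyUniformly hf).1 h).tendstoLocallyUniformlyOn

/-- Division by a linear factor preserves locally uniform convergence. -/
theorem ContConv.of_mul_sub {F H : ℕ → ℂ → ℂ} {f h : ℂ → ℂ} (hF : ContConv F f)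
    {u : ℕ → ℂ} {w₀ : ℂ} (hu : Tendsto u atTop (𝓝 w₀))
    (hH : ∀ n, Differentiable ℂ (H n)) (hh : Differentiable ℂ h)
    (hFH : ∀ᶠ n in atTop, ∀ w, F n w = (w - u n) * H n w)
    (hfh : ∀ w, f w = (w - w₀) * h w) : ContConv H h := by
  have key : ∀ x, x ≠ w₀ →
      Tendsto (fun y : ℕ × ℂ => H y.1 y.2) (atTop ×ˢ 𝓝 x) (𝓝 (h x)) := by
    intro x hx
    have h1 : Tendsto (fun y : ℕ × ℂ => y.2 - u y.1) (atTop ×ˢ 𝓝 x) (𝓝 (x - w₀)) :=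
      tendsto_snd.sub (hu.comp tendsto_fst)
    have hx' : x - w₀ ≠ 0 := sub_ne_zero.2 hx
    have h2 := (hF x).div h1 hx'
    rw [hfh x, mul_div_cancel_left₀ _ hx'] at h2
    refine h2.congr' ?_
    filter_upwards [hFH.prod_inl (𝓝 x), h1.eventually_ne hx'] with y hy hy0
    simp only [Pi.div_apply]
    rw [hy, mul_div_cancel_left₀ _ hy0]
  intro x
  rcases ne_or_eq x w₀ with hx | rfl
  · exact key x hx
  -- At `w₀` itself the quotient cannot be formed; the maximum principle on a disc around it
  -- transfers convergence from the circle, where division is harmless, to the interior.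
  have hsph : TendstoUniformlyOn H h atTop (Metric.sphere x 1) := by
    rw [← tendstoLocallyUniformlyOn_iff_tendstoUniformlyOn_of_compact (isCompact_sphere x 1),
      tendstoLocallyUniformlyOn_iff_forall_tendsto]
    intro v hv
    have hv' : v ≠ x := by
      rintro rfl
      simp at hv
    have h1 := key v hv'
    have h2 : Tendsto (fun y : ℕ × ℂ => h y.2) (atTop ×ˢ 𝓝 v) (𝓝 (h v)) :=
      (hh.continuous.tendsto v).comp tendsto_snd
    rw [tendsto_uniformity_iff_dist_tendsto_zero]
    have h3 := h2.dist h1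
    rw [dist_self] at h3
    exact h3.mono_left (Filter.prod_mono le_rfl nhdsWithin_le_nhds)
  have h2 : Tendsto (fun y : ℕ × ℂ => h y.2) (atTop ×ˢ 𝓝 x) (𝓝 (h x)) :=
    (hh.continuous.tendsto x).comp tendsto_snd
  have h3 : Tendsto (fun y : ℕ × ℂ => h y.2 - H y.1 y.2) (atTop ×ˢ 𝓝 x) (𝓝 0) := by
    rw [Metric.tendsto_nhds]
    intro ε hε
    have e1 := (Metric.tendstoUniformlyOn_iff.1 hsph) (ε / 2) (half_pos hε)
    have e2 : ∀ᶠ w in 𝓝 x, w ∈ Metric.ball x 1 := Metric.ball_mem_nhds x one_pos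
    filter_upwards [e1.prod_inl (𝓝 x), e2.prod_inr atTop]
      with y hy hyb
    have := Complex.norm_le_of_forall_mem_frontier_norm_le (U := Metric.ball x 1)
      (f := fun w => h w - H y.1 w) Metric.isBounded_ball
      ((hh.sub (hH y.1)).diffContOnCl) (C := ε / 2) (by
        intro z hz
        rw [frontier_ball x one_ne_zero] at hz
        rw [← dist_eq_norm]
        exact (hy z hz).le) (subset_closure hyb)
    rw [dist_zero_right]
    linarith
  have h4 := h2.sub h3
  simpa using h4

/-- A zero of a locally uniform limit is approximated by zeros of the sequence. -/
theorem ContConv.exists_zero_near {H : ℕ → ℂ → ℂ} {h : ℂ → ℂ} (hc : ContConv H h)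
    (hH : ∀ n, Differentiable ℂ (H n)) (hh : Differentiable ℂ h) {w₀ : ℂ} (h0 : h w₀ = 0)
    {w₁ : ℂ} (h1 : h w₁ ≠ 0) {ε : ℝ} (hε : 0 < ε) :
    ∀ᶠ n in atTop, ∃ w, dist w w₀ < ε ∧ H n w = 0 := by
  have hiso : ∀ᶠ z in 𝓝[≠] w₀, h z ≠ 0 := by
    have han : AnalyticOnNhd ℂ h Set.univ := fun z _ => hh.analyticAt z
    rcases (hh.analyticAt w₀).eventually_eq_zero_or_eventually_ne_zero with h' | h'
    · exact absurd (han.eqOn_zero_of_preconnected_of_eventuallyEq_zero isPreconnected_univ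
        (Set.mem_univ w₀) h' (Set.mem_univ w₁)) h1
    · exact h'
  obtain ⟨δ₀, hδ₀, hδ⟩ := Metric.eventually_nhds_iff.1 (eventually_nhdsWithin_iff.1 hiso)
  obtain ⟨δ, hδpos, hδlt⟩ := exists_between (lt_min hδ₀ hε)
  have hδ1 : δ < δ₀ := hδlt.trans_le (min_le_left _ _)
  have hδ2 : δ < ε := hδlt.trans_le (min_le_right _ _)
  have hcpt : IsCompact (Metric.sphere w₀ δ) := isCompact_sphere _ _
  have hne : (Metric.sphere w₀ δ).Nonempty := NormedSpace.sphere_nonempty.2 hδpos.le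
  obtain ⟨v, hv, hvmin⟩ := hcpt.exists_isMinOn hne (hh.continuous.norm.continuousOn)
  have hvne : h v ≠ 0 := by
    rw [Metric.mem_sphere] at hv
    refine hδ (by rw [hv]; exact hδ1) ?_
    rintro rfl
    simp at hv
    exact hδpos.ne hv
  set m := ‖h v‖ with hm
  have hmpos : 0 < m := norm_pos_iff.2 hvne
  have e1 := (Metric.tendstoUniformlyOn_iff.1 (hc.tendstoUniformlyOn hh.continuous hcpt))
    (m / 2) (half_pos hmpos)
  have e2 : ∀ᶠ n in atTop, ‖H n w₀‖ < m / 2 := by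
    have := (hc.tendsto (tendsto_const_nhds (x := w₀))).norm
    rw [h0, norm_zero] at this
    exact this.eventually_lt_const (half_pos hmpos)
  filter_upwards [e1, e2] with n hn1 hn2
  by_contra hcon
  push Not at hcon
  -- Without zeros in the disc, `1 / H n` is analytic there and at most `2 / m` in norm on the
  -- circle, hence also at the centre; but there `‖H n w₀‖ < m / 2`.
  have hnz : ∀ w ∈ Metric.closedBall w₀ δ, H n w ≠ 0 := fun w hw =>
    hcon w (lt_of_le_of_lt hw hδ2)
  have hd : DiffContOnCl ℂ (fun w => (H n w)⁻¹) (Metric.ball w₀ δ) := by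
    have : DifferentiableOn ℂ (fun w => (H n w)⁻¹) (Metric.closedBall w₀ δ) :=
      (hH n).differentiableOn.inv hnz
    rw [← closure_ball w₀ hδpos.ne'] at this
    exact this.diffContOnCl
  have hb := Complex.norm_le_of_forall_mem_frontier_norm_le Metric.isBounded_ball hd
    (C := (m / 2)⁻¹) (by
      intro z hz
      rw [frontier_ball w₀ hδpos.ne'] at hz
      rw [norm_inv]
      have h5 : m ≤ ‖h z‖ := hvmin hz
      have h6 := hn1 z hz
      rw [dist_eq_norm] at h6
      have h7 := norm_sub_norm_le (h z) (H n z)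
      exact inv_anti₀ (half_pos hmpos) (by linarith)) (subset_closure (Metric.mem_ball_self hδpos))
  rw [norm_inv] at hb
  have h8 : 0 < ‖H n w₀‖ := norm_pos_iff.2 (hnz w₀ (Metric.mem_closedBall_self hδpos.le))
  have h9 := (inv_le_inv₀ h8 (half_pos hmpos)).1 hb
  linarith

/-- The coefficients of polynomials converging locally uniformly converge. -/
theorem tendsto_coeff_of_contConv {P : ℕ → ℂ[X]} {g : ℕ → ℂ → ℂ} {a : ℕ → ℂ}
    (h : ContConv (fun n w => (P n).eval w) (g 0)) (hg : ∀ i, Differentiable ℂ (g i))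
    (hrec : ∀ i w, g i w = a i + w * g (i + 1) w) (i : ℕ) :
    Tendsto (fun n => (P n).coeff i) atTop (𝓝 (a i)) := by
  -- Removing the constant term and dividing by `w` preserves the convergence, so each coefficient
  -- becomes a value at `0`.
  have key : ∀ i, ContConv (fun n w => (divX^[i] (P n)).eval w) (g i) := by
    intro i
    induction i with
    | zero => exact h
    | succ i ih =>
      have h0 := ih.tendsto (tendsto_const_nhds (x := (0 : ℂ)))
      have hd : ContConv (fun n w => (divX^[i] (P n)).eval w - (divX^[i] (P n)).eval 0)
          (fun w => g i w - g i 0) := fun x => (ih x).sub (h0.comp tendsto_fst)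
      refine hd.of_mul_sub (u := fun _ => 0) (w₀ := 0) tendsto_const_nhds
        (fun n => Polynomial.differentiable _) (hg _) (Eventually.of_forall fun n w => ?_)
        (fun w => ?_)
      · rw [Function.iterate_succ_apply']
        conv_lhs => rw [← divX_mul_X_add (divX^[i] (P n))]
        simp
        ring
      · rw [hrec i w, hrec i 0]
        ring
  have hcoeff : ∀ (Q : ℂ[X]) (i : ℕ), (divX^[i] Q).eval 0 = Q.coeff i := by
    intro Q i
    induction i generalizing Q with
    | zero => rw [Function.iterate_zero, id, coeff_zero_eq_eval_zero]
    | succ i ih => rw [Function.iterate_succ_apply, ih, coeff_divX]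
  have h0 := (key i).tendsto (tendsto_const_nhds (x := (0 : ℂ)))
  simp only [hcoeff] at h0
  rw [hrec i 0] at h0
  simpa using h0

/-- Convergence of the zeros, ordered by real part, of a locally uniformly convergent sequence of
polynomials; `H k` is the limit with its first zeros `ζ 1, …, ζ (k - 1)` divided out. -/
theorem tendsto_ordered_zeros {W : ℕ → ℕ → ℂ} {K : ℕ → ℂ} {ζ : ℕ → ℝ} {H : ℕ → ℂ → ℂ}
    (hG : ContConv (fun n w => K n * ∏ i ∈ Finset.Icc 1 n, (w - W n i)) (H 1))
    (hK : ∀ᶠ n in atTop, K n ≠ 0)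
    (hmono : ∀ᶠ n in atTop, MonotoneOn (fun k => (W n k).re) (Set.Icc 1 n))
    (hbdd : ∀ R' : ℝ, ∃ R : ℝ, ∀ᶠ n in atTop, ∀ i ∈ Finset.Icc 1 n, (W n i).re ≤ R' →
      ‖W n i‖ ≤ R)
    (hH : ∀ k, 1 ≤ k → Differentiable ℂ (H k))
    (hrec : ∀ k, 1 ≤ k → ∀ w, H k w = (w - ζ k) * H (k + 1) w)
    (hne : ∀ k, 1 ≤ k → ∃ w, H k w ≠ 0)
    (hzero : ∀ k, 1 ≤ k → ∀ w, H k w = 0 → w.re ≤ ζ k → w = ζ k) {k : ℕ} (hk : 1 ≤ k) :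
    Tendsto (fun n => W n k) atTop (𝓝 (ζ k : ℂ)) := by
  set F : ℕ → ℕ → ℂ → ℂ := fun k n w => K n * ∏ i ∈ Finset.Icc k n, (w - W n i) with hF
  have hFd : ∀ k n, Differentiable ℂ (F k n) := by
    intro k n
    simp only [hF]
    fun_prop
  have hstep : ∀ k, 1 ≤ k → ContConv (F k) (H k) →
      Tendsto (fun n => W n k) atTop (𝓝 (ζ k : ℂ)) := by
    intro k hk hc
    have hzk : H k (ζ k) = 0 := by rw [hrec k hk]; simp
    obtain ⟨w₁, hw₁⟩ := hne k hk
    -- The zero supplied by Hurwitz near `ζ k` is some `W n i` with `i ≥ k`; the ordering turns it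
    -- into an upper bound for the real part of `W n k`.
    have hre : ∀ ε > 0, ∀ᶠ n in atTop, (W n k).re < ζ k + ε := by
      intro ε hε
      filter_upwards [hc.exists_zero_near (hFd k) (hH k hk) hzk hw₁ hε, hK,
        hmono, eventually_ge_atTop k] with n hn hKn hmn hkn
      obtain ⟨w, hw, hw0⟩ := hn
      simp only [hF, mul_eq_zero, hKn, false_or, Finset.prod_eq_zero_iff, Finset.mem_Icc] at hw0
      obtain ⟨i, ⟨hi1, hi2⟩, hi⟩ := hw0
      have hwi : w = W n i := sub_eq_zero.1 hi
      have h1 : (W n k).re ≤ (W n i).re :=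
        hmn ⟨hk, hkn⟩ ⟨hk.trans hi1, hi2⟩ hi1
      have h2 : |(w - ζ k).re| ≤ ‖w - ζ k‖ := Complex.abs_re_le_norm _
      rw [dist_eq_norm] at hw
      have h3 := (abs_lt.1 (h2.trans_lt hw)).2
      rw [Complex.sub_re, Complex.ofReal_re] at h3
      rw [← hwi] at h1
      linarith
    obtain ⟨R, hR⟩ := hbdd (ζ k + 1)
    have hcl : ∀ᶠ n in atTop, W n k ∈ Metric.closedBall (0 : ℂ) R := by
      filter_upwards [hR, hre 1 one_pos, eventually_ge_atTop k] with n hn h1 hkn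
      rw [mem_closedBall_zero_iff]
      exact hn k (Finset.mem_Icc.2 ⟨hk, hkn⟩) h1.le
    -- The `W n k` stay in a compact set, and any cluster point is a zero of `H k` with real part at
    -- most `ζ k`; by `hzero` only `ζ k` qualifies.
    refine (isCompact_closedBall (0 : ℂ) R).tendsto_nhds_of_unique_mapClusterPt hcl ?_
    intro w _ hw
    have hz : H k w = 0 := by
      have hcl2 : MapClusterPt (H k w) atTop (fun n => F k n (W n k)) := by
        rw [mapClusterPt_iff_ultrafilter] at hw ⊢
        obtain ⟨U, hU, hUw⟩ := hw
        exact ⟨U, hU, (hc w).comp ((tendsto_id'.2 hU).prodMk hUw)⟩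
      have h0 : Tendsto (fun n => F k n (W n k)) atTop (𝓝 0) := by
        refine tendsto_const_nhds.congr' ?_
        filter_upwards [eventually_ge_atTop k] with n hkn
        simp only [hF]
        rw [Finset.prod_eq_zero (Finset.mem_Icc.2 ⟨le_rfl, hkn⟩) (sub_self _), mul_zero]
      rw [mapClusterPt_iff_ultrafilter] at hcl2
      obtain ⟨U, hU, hUw⟩ := hcl2
      exact tendsto_nhds_unique hUw (h0.mono_left hU)
    refine hzero k hk w hz ?_
    refine le_of_forall_pos_le_add fun ε hε => ?_
    rw [mapClusterPt_iff_ultrafilter] at hw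
    obtain ⟨U, hU, hUw⟩ := hw
    refine le_of_tendsto ((Complex.continuous_re.tendsto w).comp hUw) ?_
    filter_upwards [hU (hre ε hε)] with n hn using hn.le
  have hall : ∀ k, 1 ≤ k → ContConv (F k) (H k) := by
    intro k hk
    induction k, hk using Nat.le_induction with
    | base => exact hG
    | succ k hk ih =>
      refine ih.of_mul_sub (hstep k hk ih) (hFd _) (hH _ (by lia)) ?_ (hrec k hk)
      filter_upwards [eventually_ge_atTop k] with n hn w
      simp only [hF]
      rw [← Finset.insert_Icc_add_one_left_eq_Icc hn, Finset.prod_insert (by simp)]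
      ring
  exact hstep k hk (hall k hk)

/-! ### The entire function `phi` behind the Bessel function -/

/-- The power series with real coefficients `a`, as a function on `ℂ`. -/
noncomputable def powerSum (a : ℕ → ℝ) (w : ℂ) : ℂ := ∑' m, (a m : ℂ) * w ^ m

/-- The coefficients `a` define an entire power series. -/
def EntireCoeff (a : ℕ → ℝ) : Prop := ∀ R : ℝ, 0 < R → Summable fun m => |a m| * R ^ m

theorem EntireCoeff.summable {a : ℕ → ℝ} (ha : EntireCoeff a) (w : ℂ) :
    Summable fun m => (a m : ℂ) * w ^ m := by
  have hR : 0 < ‖w‖ + 1 := by positivity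
  refine Summable.of_norm_bounded (ha _ hR) fun m => ?_
  rw [norm_mul, norm_pow, Complex.norm_real, Real.norm_eq_abs]
  gcongr
  linarith

theorem EntireCoeff.shift {a : ℕ → ℝ} (ha : EntireCoeff a) (i : ℕ) :
    EntireCoeff fun m => a (m + i) := by
  intro R hR
  have h := ((summable_nat_add_iff i).2 (ha R hR)).mul_right ((R ^ i)⁻¹)
  refine h.congr fun m => ?_
  rw [pow_add]
  field_simp

theorem EntireCoeff.powerSum_eq {a : ℕ → ℝ} (ha : EntireCoeff a) (w : ℂ) :
    powerSum a w = a 0 + w * powerSum (fun m => a (m + 1)) w := by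
  unfold powerSum
  rw [(ha.summable w).tsum_eq_zero_add, pow_zero, mul_one, ← tsum_mul_left]
  congr 1
  refine tsum_congr fun m => ?_
  ring

theorem EntireCoeff.differentiable_and_deriv {a : ℕ → ℝ} (ha : EntireCoeff a) :
    Differentiable ℂ (powerSum a) ∧
      ∀ w, deriv (powerSum a) w = powerSum (fun m => (m + 1) * a (m + 1)) w := by
  have key : ∀ w : ℂ, DifferentiableAt ℂ (powerSum a) w ∧
      deriv (powerSum a) w = powerSum (fun m => (m + 1) * a (m + 1)) w := by
    intro w
    have hR : 0 < ‖w‖ + 1 := by positivity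
    have hU : IsOpen (Metric.ball (0 : ℂ) (‖w‖ + 1)) := Metric.isOpen_ball
    have hw : w ∈ Metric.ball (0 : ℂ) (‖w‖ + 1) := by simp
    have hb : ∀ (i : ℕ) (z : ℂ), z ∈ Metric.ball (0 : ℂ) (‖w‖ + 1) →
        ‖(a i : ℂ) * z ^ i‖ ≤ |a i| * (‖w‖ + 1) ^ i := by
      intro i z hz
      rw [norm_mul, norm_pow, Complex.norm_real, Real.norm_eq_abs]
      rw [mem_ball_zero_iff] at hz
      gcongr
    have hd : ∀ i : ℕ, DifferentiableOn ℂ (fun z : ℂ => (a i : ℂ) * z ^ i)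
        (Metric.ball (0 : ℂ) (‖w‖ + 1)) := fun i => by fun_prop
    refine ⟨(Complex.differentiableOn_tsum_of_summable_norm (ha _ hR) hd hU hb).differentiableAt
      (hU.mem_nhds hw), ?_⟩
    have hs := Complex.hasSum_deriv_of_summable_norm (ha _ hR) hd hU hb hw
    have h1 := hs.tsum_eq.symm
    rw [hs.summable.tsum_eq_zero_add] at h1
    refine h1.trans ?_
    simp only [powerSum]
    simp only [deriv_const_mul_field', deriv_pow_field]
    simp only [Nat.cast_zero, zero_mul, mul_zero, zero_add]
    refine tsum_congr fun m => ?_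
    push_cast
    ring
  exact ⟨fun w => (key w).1, fun w => (key w).2⟩

/-- The Taylor coefficients of `phi`. -/
noncomputable def besselCoeff (lam : ℝ) (m : ℕ) : ℝ :=
  (-1) ^ m / ((m.factorial : ℝ) * Real.Gamma (m + lam + 1))

/-- The entire function `∑ (-1)^m w^m / (m! Γ(m + λ + 1))`. -/
noncomputable def phi (lam : ℝ) : ℂ → ℂ := powerSum (besselCoeff lam)

theorem besselEntire_eq_phi (lam : ℝ) (z : ℂ) : besselEntire lam z = phi lam (z ^ 2) := by
  unfold besselEntire phi powerSum besselCoeff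
  refine tsum_congr fun n => ?_
  push_cast
  rw [← Complex.Gamma_ofReal]
  push_cast
  rw [pow_mul]

theorem gamma_pos {lam : ℝ} (h : -1 < lam) (m : ℕ) : 0 < Real.Gamma (m + lam + 1) :=
  Real.Gamma_pos_of_pos (by have : (0 : ℝ) ≤ m := m.cast_nonneg; linarith)

theorem besselCoeff_ne_zero {lam : ℝ} (h : -1 < lam) (m : ℕ) : besselCoeff lam m ≠ 0 := by
  have := gamma_pos h m
  unfold besselCoeff
  positivity

theorem entireCoeff_besselCoeff {lam : ℝ} (h : -1 < lam) : EntireCoeff (besselCoeff lam) := by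
  intro R hR
  have h0 := gamma_pos h 0
  have h1 := gamma_pos h 1
  -- The factor `λ + 1` relating the first two Gamma values may be below `1`, while all later
  -- factors are at least `1`; hence the minimum over the first two values.
  set δ := min (Real.Gamma ((0 : ℕ) + lam + 1)) (Real.Gamma ((1 : ℕ) + lam + 1)) with hδ
  have hδpos : 0 < δ := lt_min h0 h1
  have hle : ∀ m : ℕ, δ ≤ Real.Gamma (m + lam + 1) := by
    intro m
    rcases m with _ | m
    · exact min_le_left _ _
    induction m with
    | zero => exact min_le_right _ _
    | succ m ih =>
      have hm : (0 : ℝ) ≤ m := m.cast_nonneg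
      have e : ((m + 1 + 1 : ℕ) : ℝ) + lam + 1 = (((m + 1 : ℕ) : ℝ) + lam + 1) + 1 := by
        push_cast; ring
      rw [e, Real.Gamma_add_one (by push_cast; linarith)]
      refine ih.trans (le_mul_of_one_le_left (gamma_pos h _).le ?_)
      push_cast
      linarith
  refine Summable.of_nonneg_of_le (fun m => by positivity) (fun m => ?_)
    ((Real.summable_pow_div_factorial R).mul_left δ⁻¹)
  have hg := gamma_pos h m
  unfold besselCoeff
  rw [abs_div, abs_pow, abs_neg, abs_one, one_pow, abs_of_pos (by positivity), mul_comm δ⁻¹,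
    div_mul_eq_mul_div, one_mul, div_mul_eq_div_mul_one_div, ← one_div]
  gcongr
  exact hle m

theorem differentiable_phi {lam : ℝ} (h : -1 < lam) : Differentiable ℂ (phi lam) :=
  (entireCoeff_besselCoeff h).differentiable_and_deriv.1

theorem phi_zero {lam : ℝ} (h : -1 < lam) : phi lam 0 = besselCoeff lam 0 := by
  unfold phi
  rw [(entireCoeff_besselCoeff h).powerSum_eq]
  simp

theorem phi_zero_ne_zero {lam : ℝ} (h : -1 < lam) : phi lam 0 ≠ 0 := by
  rw [phi_zero h]
  exact_mod_cast besselCoeff_ne_zero h 0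

theorem hasDerivAt_phi {lam : ℝ} (h : -1 < lam) (w : ℂ) :
    HasDerivAt (phi lam) (-phi (lam + 1) w) w := by
  have h1 := (entireCoeff_besselCoeff h).differentiable_and_deriv
  have h2 : deriv (phi lam) w = -phi (lam + 1) w := by
    refine (h1.2 w).trans ?_
    unfold phi powerSum
    rw [← tsum_neg]
    refine tsum_congr fun m => ?_
    rw [← neg_mul]
    congr 1
    norm_cast
    beta_reduce
    unfold besselCoeff
    have e : ((m + 1 : ℕ) : ℝ) + lam + 1 = (m : ℝ) + (lam + 1) + 1 := by push_cast; ring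
    rw [e, Nat.factorial_succ]
    have hg : 0 < Real.Gamma (m + (lam + 1) + 1) := gamma_pos (by linarith) m
    push_cast
    field_simp
    ring
  rw [← h2]
  exact (h1.1 w).hasDerivAt

/-- This is the three-term Bessel recurrence; it holds coefficientwise by the functional equation of
Gamma. -/
theorem phi_recurrence {lam : ℝ} (h : -1 < lam) (w : ℂ) :
    w * phi (lam + 2) w = (lam + 1) * phi (lam + 1) w - phi lam w := by
  have e0 := entireCoeff_besselCoeff h
  have e1 := entireCoeff_besselCoeff (show -1 < lam + 1 by linarith)
  have e2 := entireCoeff_besselCoeff (show -1 < lam + 2 by linarith)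
  have hc0 : (lam + 1) * besselCoeff (lam + 1) 0 = besselCoeff lam 0 := by
    unfold besselCoeff
    have hg := gamma_pos h 0
    have hl : lam + 1 ≠ 0 := by linarith
    simp only [Nat.cast_zero, zero_add, pow_zero, Nat.factorial_zero, Nat.cast_one, one_mul] at hg ⊢
    rw [Real.Gamma_add_one hl]
    field_simp
  have hcs : ∀ m, besselCoeff (lam + 2) m
      = (lam + 1) * besselCoeff (lam + 1) (m + 1) - besselCoeff lam (m + 1) := by
    intro m
    have hg := gamma_pos h (m + 1)
    have hm : (0 : ℝ) ≤ m := m.cast_nonneg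
    have hl : ((m + 1 : ℕ) : ℝ) + lam + 1 ≠ 0 := by push_cast; linarith
    unfold besselCoeff
    have a1 : (m : ℝ) + (lam + 2) + 1 = ((m + 1 : ℕ) : ℝ) + lam + 1 + 1 := by push_cast; ring
    have a2 : ((m + 1 : ℕ) : ℝ) + (lam + 1) + 1 = ((m + 1 : ℕ) : ℝ) + lam + 1 + 1 := by ring
    rw [a1, a2, Real.Gamma_add_one hl, Nat.factorial_succ, pow_succ]
    have hl' : (m : ℝ) + 1 + lam + 1 ≠ 0 := by linarith
    push_cast at hg ⊢
    field_simp
    ring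
  have key : phi (lam + 2) w = (lam + 1) * powerSum (fun m => besselCoeff (lam + 1) (m + 1)) w
      - powerSum (fun m => besselCoeff lam (m + 1)) w := by
    unfold phi powerSum
    rw [← tsum_mul_left, ← (((e1.shift 1).summable w).mul_left _).tsum_sub ((e0.shift 1).summable w)]
    refine tsum_congr fun m => ?_
    rw [hcs]
    push_cast
    ring
  have k1 : phi (lam + 1) w = _ := e1.powerSum_eq w
  have k0 : phi lam w = _ := e0.powerSum_eq w
  rw [key, k1, k0, ← hc0]
  push_cast
  ring

/-- The zeros of `phi` are simple. -/
theorem phi_succ_ne_zero_of_phi_eq_zero {lam : ℝ} (h : -1 < lam) {w : ℂ} (hw : phi lam w = 0) :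
    phi (lam + 1) w ≠ 0 := by
  intro hw1
  have hw0 : w ≠ 0 := by
    rintro rfl
    exact phi_zero_ne_zero h hw
  -- The recurrence spreads a common zero `w ≠ 0` to every order. As `phi'` is minus `phi` of the
  -- next order, all derivatives of `phi lam` at `w` then vanish, which contradicts `phi lam 0 ≠ 0`.
  have hall : ∀ k : ℕ, phi (lam + k) w = 0 ∧ phi (lam + (k + 1 : ℕ)) w = 0 := by
    intro k
    induction k with
    | zero => simpa using ⟨hw, hw1⟩
    | succ k ih =>
      refine ⟨ih.2, ?_⟩
      have hk : (0 : ℝ) ≤ k := k.cast_nonneg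
      have hr := phi_recurrence (show -1 < lam + k by linarith) w
      have e1 : lam + (k : ℝ) + 1 = lam + (k + 1 : ℕ) := by push_cast; ring
      have e2 : lam + (k : ℝ) + 2 = lam + (k + 1 + 1 : ℕ) := by push_cast; ring
      rw [e1, e2, ih.1, ih.2, mul_zero, sub_zero] at hr
      exact (mul_eq_zero.1 hr).resolve_left hw0
  have hit : ∀ k : ℕ, iteratedDeriv k (phi lam) = fun z => (-1) ^ k * phi (lam + k) z := by
    intro k
    induction k with
    | zero => simp
    | succ k ih =>
      have hk : (0 : ℝ) ≤ k := k.cast_nonneg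
      rw [iteratedDeriv_succ, ih]
      funext z
      rw [((hasDerivAt_phi (show -1 < lam + k by linarith) z).const_mul _).deriv]
      have e1 : lam + (k : ℝ) + 1 = lam + (k + 1 : ℕ) := by push_cast; ring
      rw [e1]
      ring
  have ht := Complex.taylorSeries_eq_of_entire' 0 (differentiable_phi h) (c := w)
  refine phi_zero_ne_zero h (ht.symm.trans ?_)
  simp [hit, hall]

theorem phi_ofReal_im {lam : ℝ} (x : ℝ) : (phi lam x).im = 0 := by
  have : phi lam x = ((∑' m, besselCoeff lam m * x ^ m : ℝ) : ℂ) := by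
    unfold phi powerSum
    push_cast
    rfl
  rw [this, Complex.ofReal_im]

theorem phi_ofReal_eq_zero_iff {lam : ℝ} (x : ℝ) : phi lam x = 0 ↔ (phi lam x).re = 0 := by
  rw [Complex.ext_iff]
  simp [phi_ofReal_im]

/-- The signs `(-1)^m` are absorbed by `x ≤ 0`, so no term is negative and the constant term is
positive. -/
theorem phi_neg_re_pos {lam : ℝ} (h : -1 < lam) {x : ℝ} (hx : x ≤ 0) : 0 < (phi lam x).re := by
  have he : phi lam x = ((∑' m, besselCoeff lam m * x ^ m : ℝ) : ℂ) := by
    unfold phi powerSum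
    push_cast
    rfl
  have hs : Summable fun m => besselCoeff lam m * x ^ m := by
    have := (entireCoeff_besselCoeff h).summable x
    exact_mod_cast this
  rw [he, Complex.ofReal_re]
  refine hs.tsum_pos (fun m => ?_) 0 ?_
  · have := gamma_pos h m
    unfold besselCoeff
    rw [div_mul_eq_mul_div, ← mul_pow]
    have : 0 ≤ -1 * x := by linarith
    positivity
  · have := gamma_pos h 0
    unfold besselCoeff
    simp only [pow_zero, mul_one]
    positivity

theorem hasDerivAt_phi_re {lam : ℝ} (h : -1 < lam) (x : ℝ) :
    HasDerivAt (fun x : ℝ => (phi lam x).re) (-(phi (lam + 1) x).re) x := by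
  have := (hasDerivAt_phi h (x : ℂ)).real_of_complex
  simpa using this

/-! ### Infinitely many positive zeros of `phi`, and their enumeration -/

/-- A solution of `f' = p g`, `g' = -q f` with `p, q ≥ 1 / x` cannot stay positive. -/
theorem not_forall_pos_of_deriv {f g p q : ℝ → ℝ} {X : ℝ} (hX : 0 < X)
    (hf : ∀ x, X ≤ x → HasDerivAt f (p x * g x) x)
    (hg : ∀ x, X ≤ x → HasDerivAt g (-(q x * f x)) x)
    (hp : ∀ x, X ≤ x → x⁻¹ ≤ p x) (hq : ∀ x, X ≤ x → x⁻¹ ≤ q x)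
    (hpos : ∀ x, X ≤ x → 0 < f x) : False := by
  have decay : ∀ (u u' : ℝ → ℝ) (Y δ : ℝ), 0 < Y → 0 < δ →
      (∀ x, Y ≤ x → HasDerivAt u (u' x) x) → (∀ x, Y ≤ x → u' x ≤ -(δ * x⁻¹)) →
      ∃ x, Y ≤ x ∧ u x < 0 := by
    intro u u' Y δ hY hδ hu hu'
    -- A derivative below `-δ / x` forces `u` to decrease at least like `-δ log x`, which is
    -- unbounded.
    have hanti : AntitoneOn (fun x => u x + δ * Real.log x) (Set.Ici Y) := by
      have hd : ∀ x, Y ≤ x → HasDerivAt (fun x => u x + δ * Real.log x) (u' x + δ * x⁻¹) x :=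
        fun x hx => (hu x hx).add ((Real.hasDerivAt_log (by linarith)).const_mul δ)
      refine antitoneOn_of_deriv_nonpos (convex_Ici Y)
        (fun x hx => (hd x hx).continuousAt.continuousWithinAt)
        (fun x hx => ?_) (fun x hx => ?_)
      · rw [interior_Ici] at hx
        exact (hd x hx.le).differentiableAt.differentiableWithinAt
      · rw [interior_Ici] at hx
        rw [(hd x hx.le).deriv]
        linarith [hu' x hx.le]
    have ht := (Real.tendsto_log_atTop.const_mul_atTop hδ).eventually_gt_atTop
      (u Y + δ * Real.log Y)
    obtain ⟨x, hx1, hx2⟩ := (ht.and (eventually_ge_atTop Y)).exists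
    refine ⟨x, hx2, ?_⟩
    have := hanti (Set.self_mem_Ici) hx2 hx2
    simp only at this
    linarith
  have hganti : AntitoneOn g (Set.Ici X) := by
    refine antitoneOn_of_deriv_nonpos (convex_Ici X)
      (fun x hx => (hg x hx).continuousAt.continuousWithinAt) (fun x hx => ?_) (fun x hx => ?_)
    · rw [interior_Ici] at hx
      exact (hg x hx.le).differentiableAt.differentiableWithinAt
    · rw [interior_Ici] at hx
      rw [(hg x hx.le).deriv]
      have hx0 : 0 < x := hX.trans hx
      have := mul_pos ((inv_pos.2 hx0).trans_le (hq x hx.le)) (hpos x hx.le)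
      linarith
  -- While `f` is positive, `g` decreases. Once `g` is negative, `f` falls logarithmically to
  -- negative values; if `g` never becomes negative, `f` increases and `g` itself falls in that way.
  by_cases hneg : ∃ x₀, X ≤ x₀ ∧ g x₀ < 0
  · obtain ⟨x₀, hx₀, hgx⟩ := hneg
    obtain ⟨x, hx, hfx⟩ := decay f (fun x => p x * g x) x₀ (-g x₀) (hX.trans_le hx₀)
      (by linarith) (fun x hx => hf x (hx₀.trans hx)) (fun x hx => by
        have h1 := hp x (hx₀.trans hx)
        have h2 : g x ≤ g x₀ := hganti hx₀ (hx₀.trans hx) hx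
        have h3 : 0 < x⁻¹ := inv_pos.2 (hX.trans_le (hx₀.trans hx))
        nlinarith)
    linarith [hpos x (hx₀.trans hx)]
  · push Not at hneg
    have hfmono : MonotoneOn f (Set.Ici X) := by
      refine monotoneOn_of_deriv_nonneg (convex_Ici X)
        (fun x hx => (hf x hx).continuousAt.continuousWithinAt) (fun x hx => ?_) (fun x hx => ?_)
      · rw [interior_Ici] at hx
        exact (hf x hx.le).differentiableAt.differentiableWithinAt
      · rw [interior_Ici] at hx
        rw [(hf x hx.le).deriv]
        have hx0 : 0 < x := hX.trans hx
        exact mul_nonneg ((inv_pos.2 hx0).trans_le (hp x hx.le)).le (hneg x hx.le)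
    obtain ⟨x, hx, hgx⟩ := decay g (fun x => -(q x * f x)) X (f X) hX (hpos X le_rfl) hg
      (fun x hx => by
        have h1 := hq x hx
        have h2 : f X ≤ f x := hfmono Set.self_mem_Ici hx hx
        have h3 : 0 < x⁻¹ := inv_pos.2 (hX.trans_le hx)
        have h4 := hpos X le_rfl
        nlinarith)
    linarith [hneg x hx]

/-- For `-1 < λ ≤ 0` the pair `phi λ` and `-x^(λ+1) phi (λ+1)` solves a first-order system whose
coefficients `x^(-(λ+1))` and `x^λ` are at least `1 / x` for `x ≥ 1`, so `phi λ` cannot keep its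
sign. Larger orders follow by Rolle, since `phi (λ - 1)` has derivative `-phi λ`. -/
theorem exists_phi_zero_gt {lam : ℝ} (h : -1 < lam) (X : ℝ) : ∃ x : ℝ, X < x ∧ phi lam x = 0 := by
  have base : ∀ lam : ℝ, -1 < lam → lam ≤ 0 → ∀ X : ℝ, ∃ x : ℝ, X < x ∧ phi lam x = 0 := by
    intro lam h h' X
    set Y := max X 0 + 1 with hY
    have hY1 : 1 ≤ Y := by rw [hY]; linarith [le_max_right X 0]
    have hXY : X < Y := by rw [hY]; linarith [le_max_left X 0]
    by_contra hcon
    push Not at hcon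
    have hne : ∀ x, Y ≤ x → (phi lam x).re ≠ 0 := fun x hx h0 =>
      hcon x (hXY.trans_le hx) ((phi_ofReal_eq_zero_iff x).2 h0)
    have hcont : Continuous fun x : ℝ => (phi lam x).re :=
      continuous_iff_continuousAt.2 fun x => (hasDerivAt_phi_re h x).continuousAt
    have hrp1 : ∀ x, Y ≤ x → x⁻¹ ≤ x ^ (-(lam + 1)) := by
      intro x hx
      rw [← Real.rpow_neg_one]
      exact Real.rpow_le_rpow_of_exponent_le (hY1.trans hx) (by linarith)
    have hrp2 : ∀ x, Y ≤ x → x⁻¹ ≤ x ^ lam := by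
      intro x hx
      rw [← Real.rpow_neg_one]
      exact Real.rpow_le_rpow_of_exponent_le (hY1.trans hx) (by linarith)
    -- The sign `s = ±1` allows the same oscillation argument for `phi` positive and for `phi`
    -- negative beyond `Y`.
    have hd : ∀ s : ℝ, ∀ x, Y ≤ x → HasDerivAt (fun x : ℝ => s * (phi lam x).re)
        (x ^ (-(lam + 1)) * (s * (x ^ (lam + 1) * -(phi (lam + 1) x).re))) x := by
      intro s x hx
      have hx0 : 0 < x := by linarith
      refine ((hasDerivAt_phi_re h x).const_mul s).congr_deriv ?_
      have : x ^ (-(lam + 1)) * x ^ (lam + 1) = 1 := by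
        rw [← Real.rpow_add hx0]; simp
      linear_combination (s * (phi (lam + 1) x).re) * this
    have hd2 : ∀ s : ℝ, ∀ x, Y ≤ x →
        HasDerivAt (fun x : ℝ => s * (x ^ (lam + 1) * -(phi (lam + 1) x).re))
        (-(x ^ lam * (s * (phi lam x).re))) x := by
      intro s x hx
      have hx0 : 0 < x := by linarith
      have h1 := Real.hasDerivAt_rpow_const (x := x) (p := lam + 1) (Or.inl hx0.ne')
      have h2 := (hasDerivAt_phi_re (show -1 < lam + 1 by linarith) x).neg
      refine ((h1.mul h2).const_mul s).congr_deriv ?_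
      have hr := congrArg Complex.re (phi_recurrence h (x : ℂ))
      simp only [Complex.mul_re, Complex.ofReal_re, Complex.ofReal_im, zero_mul, sub_zero,
        Complex.sub_re, Complex.add_re, Complex.add_im, Complex.one_re, Complex.one_im,
        add_zero] at hr
      have e : x ^ (lam + 1) = x ^ lam * x := by
        rw [Real.rpow_add hx0, Real.rpow_one]
      have e2 : lam + 1 + 1 = lam + 2 := by ring
      simp only [Pi.neg_apply]
      rw [e, e2, add_sub_cancel_right]
      linear_combination (s * x ^ lam) * hr
    rcases lt_or_gt_of_ne (hne Y le_rfl) with hneg | hpos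
    · refine not_forall_pos_of_deriv (by linarith : 0 < Y) (hd (-1)) (hd2 (-1)) hrp1 hrp2 ?_
      intro x hx
      by_contra hx0
      push Not at hx0
      obtain ⟨y, hy, hy0⟩ := intermediate_value_Icc hx hcont.continuousOn
        (show (0 : ℝ) ∈ _ from ⟨hneg.le, by linarith⟩)
      exact hne y hy.1 hy0
    · refine not_forall_pos_of_deriv (by linarith : 0 < Y) (hd 1) (hd2 1) hrp1 hrp2 ?_
      intro x hx
      by_contra hx0
      push Not at hx0
      obtain ⟨y, hy, hy0⟩ := intermediate_value_Icc' hx hcont.continuousOn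
        (show (0 : ℝ) ∈ _ from ⟨by linarith, hpos.le⟩)
      exact hne y hy.1 hy0
  have step : ∀ (k : ℕ) (lam : ℝ), -1 < lam → lam ≤ k → ∀ X : ℝ, ∃ x : ℝ, X < x ∧ phi lam x = 0 := by
    intro k
    induction k with
    | zero => simpa using base
    | succ k ih =>
      intro lam h h' X
      rcases le_or_gt lam 0 with h0 | h0
      · exact base lam h h0 X
      have hl : -1 < lam - 1 := by linarith
      have hih := ih (lam - 1) hl (by push_cast at h'; linarith)
      obtain ⟨x₁, hx₁, hz₁⟩ := hih X
      obtain ⟨x₂, hx₂, hz₂⟩ := hih x₁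
      obtain ⟨y, hy, hy0⟩ := exists_hasDerivAt_eq_zero (f := fun x : ℝ => (phi (lam - 1) x).re)
        (f' := fun x : ℝ => -(phi (lam - 1 + 1) x).re) hx₂
        (fun x _ => (hasDerivAt_phi_re hl x).continuousAt.continuousWithinAt)
        (by simp [hz₁, hz₂]) (fun x _ => hasDerivAt_phi_re hl x)
      refine ⟨y, hx₁.trans hy.1, ?_⟩
      rw [sub_add_cancel] at hy0
      exact (phi_ofReal_eq_zero_iff y).2 (by linarith)
  exact step ⌈lam⌉₊ lam h (Nat.le_ceil lam) X

/-- An unbounded set of reals with finite initial segments is enumerated increasingly. -/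
theorem exists_strictMono_range_eq {S : Set ℝ} (hfin : ∀ R, (S ∩ Set.Iic R).Finite)
    (hunb : ∀ R, ∃ x ∈ S, R < x) : ∃ x : ℕ → ℝ, StrictMono x ∧ Set.range x = S := by
  have hnext : ∀ P : ℝ → Prop, (∃ x ∈ S, P x) → ∃ x ∈ S, P x ∧ ∀ y ∈ S, P y → x ≤ y := by
    rintro P ⟨x, hx, hP⟩
    have hf : (S ∩ Set.Iic x ∩ {y | P y}).Finite := (hfin x).subset Set.inter_subset_left
    obtain ⟨m, hm, hmin⟩ := hf.exists_minimal ⟨x, ⟨hx, Set.self_mem_Iic⟩, hP⟩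
    refine ⟨m, hm.1.1, hm.2, fun y hy hPy => ?_⟩
    rcases le_total y x with hyx | hyx
    · rcases le_total m y with h | h
      · exact h
      · exact hmin ⟨⟨hy, hyx⟩, hPy⟩ h
    · exact le_trans hm.1.2 hyx
  have hn : ∀ R, ∃ x ∈ S, R < x ∧ ∀ y ∈ S, R < y → x ≤ y := fun R => hnext _ (hunb R)
  choose next hnS hnlt hnmin using hn
  obtain ⟨x₀, hx₀, -, hx₀min⟩ := hnext (fun _ => True) (by
    obtain ⟨x, hx, -⟩ := hunb 0
    exact ⟨x, hx, trivial⟩)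
  set x : ℕ → ℝ := fun n => next^[n] x₀ with hxdef
  have hxs : ∀ n, x (n + 1) = next (x n) := fun n => Function.iterate_succ_apply' _ _ _
  have hmono : StrictMono x := strictMono_nat_of_lt_succ fun n => by
    rw [hxs]; exact hnlt _
  have hxS : ∀ n, x n ∈ S := by
    intro n
    cases n with
    | zero => exact hx₀
    | succ n => rw [hxs]; exact hnS _
  refine ⟨x, hmono, Set.Subset.antisymm (Set.range_subset_iff.2 hxS) fun s hs => ?_⟩
  by_contra hns
  have hlt : ∀ n, x n < s := by
    intro n
    induction n with
    | zero => exact lt_of_le_of_ne (hx₀min s hs trivial) fun h => hns ⟨0, h⟩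
    | succ n ih =>
      refine lt_of_le_of_ne ?_ fun h => hns ⟨n + 1, h⟩
      rw [hxs]
      exact hnmin _ s hs ih
  exact Set.infinite_range_of_injective hmono.injective
    ((hfin s).subset (Set.range_subset_iff.2 fun n => ⟨hxS n, (hlt n).le⟩))

theorem besselJ_eq_zero_iff (lam : ℝ) {y : ℝ} (hy : 0 < y) :
    besselJ lam y = 0 ↔ phi lam (((y / 2) ^ 2 : ℝ) : ℂ) = 0 := by
  have hz : ((y / 2 : ℝ) : ℂ) ≠ 0 := by
    have : y / 2 ≠ 0 := by positivity
    exact_mod_cast this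
  have h := besselEntire_eq lam hz
  rw [besselEntire_eq_phi] at h
  have e : (2 : ℂ) * ((y / 2 : ℝ) : ℂ) = y := by push_cast; ring
  rw [e] at h
  push_cast at h ⊢
  rw [h, mul_eq_zero, Complex.cpow_eq_zero_iff]
  push_cast at hz
  simp [hz]

/-- The positive zeros of `phi λ` in increasing order, and the corresponding zeros of `J_λ`. -/
theorem exists_phi_zeros {lam : ℝ} (h : -1 < lam) :
    ∃ x : ℕ → ℝ, StrictMono x ∧ (∀ i, 0 < x i) ∧ (∀ i, phi lam (x i) = 0) ∧
      (∀ y : ℝ, 0 < y → phi lam y = 0 → ∃ i, x i = y) ∧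
      ∀ i, IsKthPositiveBesselZero lam (i + 1) (2 * √(x i)) := by
  have hfin : ∀ R, ({y : ℝ | 0 < y ∧ phi lam y = 0} ∩ Set.Iic R).Finite := by
    intro R
    have han : AnalyticOnNhd ℂ (phi lam) Set.univ := fun z _ => (differentiable_phi h).analyticAt z
    -- Infinitely many zeros in a bounded interval would accumulate, and the identity theorem would
    -- make `phi lam` vanish at `0`.
    by_contra hinf
    have hinf' : (Complex.ofReal '' ({y : ℝ | 0 < y ∧ phi lam y = 0} ∩ Set.Iic R)).Infinite :=
      Set.Infinite.image Complex.ofReal_injective.injOn hinf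
    have hsub : Complex.ofReal '' ({y : ℝ | 0 < y ∧ phi lam y = 0} ∩ Set.Iic R) ⊆
        Complex.ofReal '' Set.Icc 0 R := Set.image_mono fun y hy => ⟨hy.1.1.le, hy.2⟩
    have hcpt : IsCompact (Complex.ofReal '' Set.Icc 0 R) :=
      isCompact_Icc.image Complex.continuous_ofReal
    obtain ⟨w, -, hw⟩ := hinf'.exists_accPt_of_subset_isCompact hcpt hsub
    have hfr : ∃ᶠ z in 𝓝[≠] w, phi lam z = 0 := by
      refine (accPt_iff_frequently_nhdsNE.1 hw).mono ?_
      rintro _ ⟨y, hy, rfl⟩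
      exact hy.1.2
    exact phi_zero_ne_zero h (han.eqOn_zero_of_preconnected_of_frequently_eq_zero
      isPreconnected_univ (Set.mem_univ w) hfr (Set.mem_univ 0))
  obtain ⟨x, hmono, hrange⟩ := exists_strictMono_range_eq hfin (fun R => by
    obtain ⟨y, hy, hy0⟩ := exists_phi_zero_gt h (max R 0)
    exact ⟨y, ⟨(le_max_right _ _).trans_lt hy, hy0⟩, (le_max_left _ _).trans_lt hy⟩)
  have hx : ∀ i, 0 < x i ∧ phi lam (x i) = 0 := fun i => by
    have : x i ∈ Set.range x := ⟨i, rfl⟩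
    rw [hrange] at this
    exact this
  have hsurj : ∀ y : ℝ, 0 < y → phi lam y = 0 → ∃ i, x i = y := fun y hy hy0 => by
    have : y ∈ Set.range x := by rw [hrange]; exact ⟨hy, hy0⟩
    exact this
  have hsq : ∀ i, (2 * √(x i) / 2) ^ 2 = x i := fun i => by
    rw [mul_div_cancel_left₀ _ two_ne_zero, Real.sq_sqrt (hx i).1.le]
  have hpos : ∀ i, 0 < 2 * √(x i) := fun i => mul_pos two_pos (Real.sqrt_pos.2 (hx i).1)
  refine ⟨x, hmono, fun i => (hx i).1, fun i => (hx i).2, hsurj, fun i => ⟨hpos i, ?_, ?_⟩⟩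
  · rw [besselJ_eq_zero_iff lam (hpos i), hsq]
    exact (hx i).2
  · have hset : {y : ℝ | 0 < y ∧ y ≤ 2 * √(x i) ∧ besselJ lam y = 0} =
        (fun l => 2 * √(x l)) '' Set.Iic i := by
      ext y
      simp only [Set.mem_ofPred_eq, Set.mem_image, Set.mem_Iic]
      constructor
      · rintro ⟨hy, hyle, hy0⟩
        rw [besselJ_eq_zero_iff lam hy] at hy0
        obtain ⟨l, hl⟩ := hsurj _ (by positivity) hy0
        have hyl : 2 * √(x l) = y := by
          rw [hl, Real.sqrt_sq (by positivity)]
          ring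
        refine ⟨l, ?_, hyl⟩
        rw [← hyl] at hyle
        have := (Real.sqrt_le_sqrt_iff (hx i).1.le).1 (le_of_mul_le_mul_left hyle two_pos)
        exact hmono.le_iff_le.1 this
      · rintro ⟨l, hl, rfl⟩
        refine ⟨hpos l, ?_, ?_⟩
        · have := Real.sqrt_le_sqrt (hmono.monotone hl)
          linarith
        · rw [besselJ_eq_zero_iff lam (hpos l), hsq]
          exact (hx l).2
    have hinj : Function.Injective fun l => 2 * √(x l) := fun l l' hll => by
      have := congrArg (fun t => (t / 2) ^ 2) hll
      simp only [hsq] at this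
      exact hmono.injective this
    rw [hset, hinj.injOn.encard_image]
    have : (Set.Iic i) = ((Finset.range (i + 1) : Finset ℕ) : Set ℕ) := by
      ext l
      simp
    rw [this, Set.encard_coe_eq_coe_finsetCard, Finset.card_range]

/-! ### Expansions in orthonormal polynomials of a bilinear form -/

section Bilinear

variable {B : ℝ[X] →ₗ[ℝ] ℝ[X] →ₗ[ℝ] ℝ} {P : ℕ → ℝ[X]}

theorem IsOrthonormalPolynomials.degree_eq {B : ℝ[X] → ℝ[X] → ℝ}
    (hP : IsOrthonormalPolynomials B P) (n : ℕ) : (P n).degree = n := by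
  rw [degree_eq_natDegree (leadingCoeff_ne_zero.1 (hP.leadingCoeff_pos n).ne'), hP.natDegree_eq]

theorem IsOrthonormalPolynomials.coeff_self {B : ℝ[X] → ℝ[X] → ℝ}
    (hP : IsOrthonormalPolynomials B P) (n : ℕ) : (P n).coeff n = (P n).leadingCoeff := by
  rw [leadingCoeff, hP.natDegree_eq]

theorem degree_sub_smul_lt {p f : ℝ[X]} {n : ℕ} (hp : p.natDegree = n) (hp0 : p.leadingCoeff ≠ 0)
    (hf : f.degree < (n + 1 : ℕ)) : (f - (f.coeff n / p.leadingCoeff) • p).degree < n := by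
  rw [degree_lt_iff_coeff_zero] at hf ⊢
  intro m hm
  rw [coeff_sub, coeff_smul, smul_eq_mul]
  rcases hm.eq_or_lt with rfl | hm
  · have : p.coeff n = p.leadingCoeff := by rw [leadingCoeff, hp]
    rw [this, div_mul_cancel₀ _ hp0, sub_self]
  · rw [hf m hm, coeff_eq_zero_of_natDegree_lt (by lia : p.natDegree < m)]
    ring

/-- A polynomial of degree less than `n` is a combination of the first `n` orthonormal
polynomials. -/
theorem IsOrthonormalPolynomials.exists_eq_sum {B : ℝ[X] → ℝ[X] → ℝ}
    (hP : IsOrthonormalPolynomials B P) {n : ℕ} {f : ℝ[X]} (hf : f.degree < n) :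
    ∃ a : ℕ → ℝ, f = ∑ k ∈ Finset.range n, a k • P k := by
  induction n generalizing f with
  | zero =>
    refine ⟨0, ?_⟩
    rw [Finset.range_zero, Finset.sum_empty]
    rw [degree_lt_iff_coeff_zero] at hf
    ext m
    simpa using hf m (Nat.zero_le m)
  | succ n ih =>
    obtain ⟨a, ha⟩ := ih (degree_sub_smul_lt (hP.natDegree_eq n) (hP.leadingCoeff_pos n).ne' hf)
    refine ⟨Function.update a n (f.coeff n / (P n).leadingCoeff), ?_⟩
    rw [Finset.sum_range_succ, Function.update_self]
    have : ∑ k ∈ Finset.range n, Function.update a n (f.coeff n / (P n).leadingCoeff) k • P k =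
        ∑ k ∈ Finset.range n, a k • P k := by
      refine Finset.sum_congr rfl fun k hk => ?_
      rw [Function.update_of_ne (Finset.mem_range.1 hk).ne]
    rw [this, ← ha]
    abel

variable (hP : IsOrthonormalPolynomials (fun f g => B f g) P)
include hP

theorem IsOrthonormalPolynomials.apply_of_degree_lt {n : ℕ} {f : ℝ[X]} (hf : f.degree < n) :
    B (P n) f = 0 ∧ B f (P n) = 0 := by
  obtain ⟨a, rfl⟩ := hP.exists_eq_sum hf
  simp only [map_sum, map_smul, LinearMap.sum_apply, LinearMap.smul_apply]
  constructor
  · refine Finset.sum_eq_zero fun k hk => ?_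
    have := hP.orthonormal n k
    rw [this, if_neg (Finset.mem_range.1 hk).ne', smul_zero]
  · refine Finset.sum_eq_zero fun k hk => ?_
    have := hP.orthonormal k n
    rw [this, if_neg (Finset.mem_range.1 hk).ne, smul_zero]

theorem IsOrthonormalPolynomials.eq_sum_of_degree_lt {n : ℕ} {f : ℝ[X]} (hf : f.degree < n) :
    f = ∑ k ∈ Finset.range n, B f (P k) • P k := by
  obtain ⟨a, ha⟩ := hP.exists_eq_sum hf
  have : ∀ k ∈ Finset.range n, B f (P k) = a k := by
    intro k hk
    conv_lhs => rw [ha]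
    simp only [map_sum, map_smul, LinearMap.sum_apply, LinearMap.smul_apply]
    rw [Finset.sum_eq_single k]
    · have := hP.orthonormal k k
      simp only [if_true] at this
      rw [this, smul_eq_mul, mul_one]
    · intro l _ hl
      have := hP.orthonormal l k
      simp only [if_neg hl] at this
      rw [this, smul_zero]
    · exact fun h => absurd hk h
  conv_lhs => rw [ha]
  exact Finset.sum_congr rfl fun k hk => by rw [this k hk]

theorem IsOrthonormalPolynomials.apply_of_degree_le {n : ℕ} {f : ℝ[X]}
    (hf : f.degree < (n + 1 : ℕ)) : B f (P n) = f.coeff n / (P n).leadingCoeff := by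
  have h1 := degree_sub_smul_lt (hP.natDegree_eq n) (hP.leadingCoeff_pos n).ne' hf
  have h2 := (hP.apply_of_degree_lt h1).2
  have h3 := hP.orthonormal n n
  simp only [if_true] at h3
  rw [map_sub, map_smul, LinearMap.sub_apply, LinearMap.smul_apply, h3, smul_eq_mul, mul_one] at h2
  linarith

end Bilinear

/-! ### Nonnegative functionals on the half-line and zeros of their orthonormal polynomials -/

/-- The bilinear form `(f, g) ↦ L (f g)`. -/
noncomputable def polyForm (L : ℝ[X] →ₗ[ℝ] ℝ) : ℝ[X] →ₗ[ℝ] ℝ[X] →ₗ[ℝ] ℝ :=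
  (LinearMap.mul ℝ ℝ[X]).compr₂ L

@[simp]
theorem polyForm_apply (L : ℝ[X] →ₗ[ℝ] ℝ) (f g : ℝ[X]) : polyForm L f g = L (f * g) := rfl

/-- The functional `f ↦ L (X^(2 j) f)`. -/
noncomputable def shiftFunctional (L : ℝ[X] →ₗ[ℝ] ℝ) (j : ℕ) : ℝ[X] →ₗ[ℝ] ℝ :=
  L ∘ₗ LinearMap.mulLeft ℝ (X ^ (2 * j))

@[simp]
theorem shiftFunctional_apply (L : ℝ[X] →ₗ[ℝ] ℝ) (j : ℕ) (f : ℝ[X]) :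
    shiftFunctional L j f = L (X ^ (2 * j) * f) := rfl

theorem shiftFunctional_shiftFunctional (L : ℝ[X] →ₗ[ℝ] ℝ) (i j : ℕ) :
    shiftFunctional (shiftFunctional L i) j = shiftFunctional L (i + j) := by
  refine LinearMap.ext fun f => ?_
  simp only [shiftFunctional_apply]
  rw [← mul_assoc, ← pow_add, mul_add]

theorem shiftFunctional_zero (L : ℝ[X] →ₗ[ℝ] ℝ) : shiftFunctional L 0 = L := by
  refine LinearMap.ext fun f => ?_
  simp

/-- `L` is nonnegative on polynomials that are nonnegative on `[0, ∞)`. -/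
def NonnegFunctional (L : ℝ[X] →ₗ[ℝ] ℝ) : Prop :=
  ∀ f : ℝ[X], (∀ t : ℝ, 0 ≤ t → 0 ≤ f.eval t) → 0 ≤ L f

theorem NonnegFunctional.shift {L : ℝ[X] →ₗ[ℝ] ℝ} (hL : NonnegFunctional L) (j : ℕ) :
    NonnegFunctional (shiftFunctional L j) := fun f hf =>
  hL (X ^ (2 * j) * f) fun t ht => by
  rw [eval_mul, eval_pow, eval_X]
  exact mul_nonneg (by positivity) (hf t ht)

/-- The degenerate case of the Cauchy–Schwarz inequality. -/
theorem NonnegFunctional.apply_eq_zero {L : ℝ[X] →ₗ[ℝ] ℝ} (hL : NonnegFunctional L) {Q h : ℝ[X]}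
    (hQ : ∀ t : ℝ, 0 ≤ t → 0 ≤ Q.eval t) (h0 : L (Q * (h * h)) = 0) (f : ℝ[X]) :
    L (Q * (h * f)) = 0 := by
  -- In `L (Q (s h + f)²) ≥ 0` the quadratic term vanishes, and an affine function of `s` bounded
  -- below has slope zero.
  have key : ∀ s : ℝ, 0 ≤ s * (2 * L (Q * (h * f))) + L (Q * (f * f)) := by
    intro s
    have h1 := hL (Q * ((s • h + f) * (s • h + f))) fun t ht => by
      rw [eval_mul, eval_mul]
      exact mul_nonneg (hQ t ht) (mul_self_nonneg _)
    have e : Q * ((s • h + f) * (s • h + f)) =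
        (s * s) • (Q * (h * h)) + (2 * s) • (Q * (h * f)) + Q * (f * f) := by
      simp only [smul_eq_C_mul, C_mul, C_ofNat]
      ring
    rw [e, map_add, map_add, map_smul, map_smul, h0] at h1
    simp only [smul_eq_mul] at h1
    linarith
  by_contra hne
  have := key (-(L (Q * (f * f)) + 1) / (2 * L (Q * (h * f))))
  rw [div_mul_cancel₀ _ (by simpa using hne)] at this
  linarith

section Functional

variable {L : ℝ[X] →ₗ[ℝ] ℝ} (hL : NonnegFunctional L) {P : ℕ → ℝ[X]}
  (hP : IsOrthonormalPolynomials (fun f g => polyForm L f g) P)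
include hL hP

/-- An orthonormal polynomial has no nontrivial factor of constant sign. -/
theorem orthonormal_ne_mul_of_nonneg {n : ℕ} {Q h : ℝ[X]}
    (hQ : ∀ t : ℝ, 0 ≤ t → 0 ≤ Q.eval t) (hh : h.degree < n) : P n ≠ Q * h := by
  intro he
  have h1 : L (Q * (h * h)) = 0 := by
    rw [← mul_assoc, ← he]
    exact (hP.apply_of_degree_lt hh).1
  -- Taking `f = Q h` in the degenerate Cauchy–Schwarz inequality gives `L (P n ^ 2) = 0`, against
  -- the normalization.
  have h2 := hL.apply_eq_zero hQ h1 (Q * h)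
  have h3 := hP.orthonormal n n
  simp only [if_true, polyForm_apply] at h3
  rw [he] at h3
  have e : Q * (h * (Q * h)) = Q * h * (Q * h) := by ring
  rw [e] at h2
  linarith

omit hL in
theorem degree_lt_of_orthonormal_eq_mul {n : ℕ} {Q h : ℝ[X]} (he : P n = Q * h)
    (hQ : 0 < Q.natDegree) : h.degree < n := by
  have hP0 : P n ≠ 0 := leadingCoeff_ne_zero.1 (hP.leadingCoeff_pos n).ne'
  have hQ0 : Q ≠ 0 := fun h0 => hP0 (by rw [he, h0, zero_mul])
  have hh0 : h ≠ 0 := fun h0 => hP0 (by rw [he, h0, mul_zero])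
  have := hP.natDegree_eq n
  rw [he, natDegree_mul hQ0 hh0] at this
  rw [degree_eq_natDegree hh0]
  exact_mod_cast (by lia : h.natDegree < n)

theorem orthonormal_root_pos {n : ℕ} {x : ℝ} (hx : (P n).eval x = 0) : 0 < x := by
  by_contra hneg
  push Not at hneg
  obtain ⟨h, hh⟩ := dvd_iff_isRoot.2 hx
  exact orthonormal_ne_mul_of_nonneg hL hP (fun t ht => by simp; linarith)
    (degree_lt_of_orthonormal_eq_mul hP hh (by simp)) hh

theorem orthonormal_eval_zero_ne_zero (n : ℕ) : (P n).eval 0 ≠ 0 := fun h =>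
  lt_irrefl _ (orthonormal_root_pos hL hP h)

/-- The complex zeros of an orthonormal polynomial are real and positive. -/
theorem orthonormal_aeval_root {n : ℕ} {z : ℂ} (hz : aeval z (P n) = 0) :
    ∃ x : ℝ, 0 < x ∧ z = x := by
  have him : z.im = 0 := by
    by_contra him
    -- A non-real zero gives the real factor `|t - z|²`, which is nonnegative; likewise `X - x` with
    -- `x ≤ 0` and a squared linear factor are excluded in the neighbouring lemmas.
    obtain ⟨h, hh⟩ := quadratic_dvd_of_aeval_eq_zero_im_ne_zero (P n) hz him
    refine orthonormal_ne_mul_of_nonneg hL hP (fun t ht => ?_)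
      (degree_lt_of_orthonormal_eq_mul hP hh ?_) hh
    · simp only [eval_add, eval_sub, eval_pow, eval_X, eval_mul, eval_C]
      rw [Complex.sq_norm, Complex.normSq_apply]
      nlinarith [sq_nonneg (t - z.re), sq_nonneg z.im]
    · have : (X ^ 2 - C (2 * z.re) * X + C (‖z‖ ^ 2)).natDegree = 2 := by compute_degree!
      lia
  have hzx : z = (z.re : ℂ) := Complex.ext rfl (by simpa using him)
  refine ⟨z.re, ?_, hzx⟩
  rw [hzx] at hz
  refine orthonormal_root_pos hL hP (n := n) ?_
  have h2 : aeval ((z.re : ℝ) : ℂ) (P n) = (((P n).eval z.re : ℝ) : ℂ) := by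
    rw [← Complex.coe_algebraMap, aeval_algebraMap_apply, coe_aeval_eq_eval]
  rw [h2] at hz
  exact_mod_cast hz

theorem orthonormal_roots_nodup (n : ℕ) : (P n).roots.Nodup := by
  rw [Multiset.nodup_iff_count_le_one]
  intro x
  by_contra hlt
  push Not at hlt
  rw [count_roots] at hlt
  have hP0 : P n ≠ 0 := leadingCoeff_ne_zero.1 (hP.leadingCoeff_pos n).ne'
  obtain ⟨h, hh⟩ := (le_rootMultiplicity_iff hP0).1 (show 2 ≤ rootMultiplicity x (P n) from hlt)
  refine orthonormal_ne_mul_of_nonneg hL hP (fun t _ => ?_)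
    (degree_lt_of_orthonormal_eq_mul hP hh ?_) hh
  · rw [eval_pow]
    positivity
  · rw [natDegree_pow, natDegree_X_sub_C]
    norm_num

theorem orthonormal_card_roots (n : ℕ) : (P n).roots.card = n := by
  have hs : (P n).Splits := by
    have hs : ((P n).map (algebraMap ℝ ℂ)).Splits := IsAlgClosed.splits _
    refine hs.of_splits_map_of_injective (algebraMap ℝ ℂ).injective fun z hz => ?_
    have hz' : aeval z (P n) = 0 := by
      rw [← eval_map_algebraMap]
      exact isRoot_of_mem_roots hz
    obtain ⟨x, -, rfl⟩ := orthonormal_aeval_root hL hP hz'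
    exact ⟨x, rfl⟩
  rw [← hs.natDegree_eq_card_roots, hP.natDegree_eq]

/-- If `L (g²) = 0`, degenerate Cauchy–Schwarz makes `g` orthogonal to every polynomial, so all its
expansion coefficients vanish. -/
theorem functional_sq_pos {g : ℝ[X]} (hg : g ≠ 0) : 0 < L (g * g) := by
  have h1 : 0 ≤ L (g * g) := hL _ fun t _ => by
    rw [eval_mul]
    exact mul_self_nonneg _
  refine lt_of_le_of_ne h1 fun h0 => hg ?_
  have h2 := hL.apply_eq_zero (Q := 1) (h := g) (fun t _ => by simp) (by rw [one_mul, ← h0])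
  have hd : g.degree < (g.natDegree + 1 : ℕ) :=
    degree_le_natDegree.trans_lt (by exact_mod_cast Nat.lt_succ_self _)
  rw [hP.eq_sum_of_degree_lt hd]
  refine Finset.sum_eq_zero fun k _ => ?_
  have := h2 (P k)
  rw [one_mul] at this
  rw [polyForm_apply, this, zero_smul]

/-! ### The Christoffel step from `L` to `x² L`: leading coefficients, partial fractions, sector
bound -/

variable {P' : ℕ → ℝ[X]}
  (hP' : IsOrthonormalPolynomials (fun f g => polyForm (shiftFunctional L 1) f g) P')
include hP'

omit hL in
theorem functional_X_mul_mul (n : ℕ) :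
    L (X * P' n * P (n + 1)) = (P' n).leadingCoeff / (P (n + 1)).leadingCoeff := by
  have hd : degree (X * P' n) < ((n + 1 + 1 : ℕ) : WithBot ℕ) := by
    rw [degree_mul, degree_X, hP'.degree_eq]
    exact_mod_cast (by lia : 1 + n < n + 1 + 1)
  have h := hP.apply_of_degree_le hd
  rw [polyForm_apply, coeff_X_mul, hP'.coeff_self] at h
  exact h

/-- With `a` the quotient of the leading coefficients, `X P' n - a P (n+1)` has squared norm `1 -
a²`. -/
theorem leadingCoeff_christoffel_le (n : ℕ) :
    (P' n).leadingCoeff ≤ (P (n + 1)).leadingCoeff := by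
  have h1 := functional_X_mul_mul hP hP' n
  set a := (P' n).leadingCoeff / (P (n + 1)).leadingCoeff with ha
  have h2 := hP.orthonormal (n + 1) (n + 1)
  have h3 := hP'.orthonormal n n
  simp only [if_true, polyForm_apply, shiftFunctional_apply] at h2 h3
  have h4 := hL ((X * P' n - a • P (n + 1)) * (X * P' n - a • P (n + 1))) fun t _ => by
    rw [eval_mul]
    exact mul_self_nonneg _
  have e : (X * P' n - a • P (n + 1)) * (X * P' n - a • P (n + 1)) =
      X ^ (2 * 1) * (P' n * P' n) - (2 * a) • (X * P' n * P (n + 1)) +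
        (a * a) • (P (n + 1) * P (n + 1)) := by
    simp only [smul_eq_C_mul, C_mul, C_ofNat]
    ring
  rw [e, map_add, map_sub, map_smul, map_smul, h1, h2, h3] at h4
  simp only [smul_eq_mul] at h4
  have hpos := hP.leadingCoeff_pos (n + 1)
  have ha1 : a ≤ 1 := by nlinarith
  rwa [ha, div_le_one hpos] at ha1

/-- The residues of `P' n / P (n + 1)` are nonnegative. -/
theorem eval_christoffel_mul_nonneg {n : ℕ} {x : ℝ} {g : ℝ[X]} (hg : P (n + 1) = (X - C x) * g) :
    0 ≤ (P' n).eval x * g.eval x := by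
  have hx : 0 < x := orthonormal_root_pos hL hP (n := n + 1) (by rw [hg]; simp)
  have hgd : g.degree < (n + 1 : ℕ) := degree_lt_of_orthonormal_eq_mul hP hg (by simp)
  have hg0 : g ≠ 0 := by
    rintro rfl
    have := hP.leadingCoeff_pos (n + 1)
    rw [hg] at this
    simp at this
  have hglc : g.coeff n = (P (n + 1)).leadingCoeff := by
    rw [← hP.coeff_self, hg, sub_mul, coeff_sub, coeff_X_mul, coeff_C_mul]
    rw [degree_lt_iff_coeff_zero] at hgd
    rw [hgd (n + 1) le_rfl]
    ring
  have h1 : L (X ^ (2 * 1) * (g * P' n)) = (P (n + 1)).leadingCoeff / (P' n).leadingCoeff := by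
    have := hP'.apply_of_degree_le hgd
    rw [hglc] at this
    exact this
  have h2 := functional_X_mul_mul hP hP' n
  -- The left side is the reciprocal of the ratio `L (X P' n P (n+1)) ≤ 1`, so the remaining term `x
  -- L (X P' n g)` is nonnegative.
  have h3 : L (X ^ (2 * 1) * (g * P' n)) = L (X * P' n * P (n + 1)) + x * L (X * P' n * g) := by
    rw [← smul_eq_mul x, ← map_smul, ← map_add]
    congr 1
    rw [hg, smul_eq_C_mul]
    ring
  -- This combination vanishes at `x`; multiplied by `g` it becomes `h P (n+1)`, which `L` kills. So
  -- the sign of `L (X P' n g)` passes to `P' n (x) g (x)`, where `g (x)` is the derivative of `P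
  -- (n+1)` at `x`.
  obtain ⟨h, hh⟩ : (X - C x) ∣ C (g.eval x) * (X * P' n) - C (x * (P' n).eval x) * g := by
    rw [dvd_iff_isRoot, IsRoot]
    simp only [eval_sub, eval_mul, eval_C, eval_X]
    ring
  have hhd : h.degree < (n + 1 : ℕ) := by
    have hd : degree (C (g.eval x) * (X * P' n) - C (x * (P' n).eval x) * g) <
        ((n + 1 + 1 : ℕ) : WithBot ℕ) := by
      rw [degree_lt_iff_coeff_zero] at hgd ⊢
      intro m hm
      obtain ⟨m, rfl⟩ : ∃ k, m = k + 1 := ⟨m - 1, by lia⟩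
      rw [coeff_sub, coeff_C_mul, coeff_C_mul, coeff_X_mul, hgd _ (by lia),
        coeff_eq_zero_of_natDegree_lt (by rw [hP'.natDegree_eq]; lia)]
      ring
    rw [hh, degree_mul, degree_X_sub_C] at hd
    rcases eq_or_ne h 0 with rfl | h0
    · simp
    rw [degree_eq_natDegree h0] at hd ⊢
    have hd' : 1 + h.natDegree < n + 1 + 1 := by exact_mod_cast hd
    exact_mod_cast (by lia : h.natDegree < n + 1)
  have h4 : g.eval x * L (X * P' n * g) = x * (P' n).eval x * L (g * g) := by
    have h5 : L (h * P (n + 1)) = 0 := (hP.apply_of_degree_lt hhd).2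
    have e : h * P (n + 1) = g.eval x • (X * P' n * g) - (x * (P' n).eval x) • (g * g) := by
      rw [hg, smul_eq_C_mul, smul_eq_C_mul]
      linear_combination (-g) * hh
    rw [e, map_sub, map_smul, map_smul] at h5
    simp only [smul_eq_mul] at h5
    linarith
  have hle := leadingCoeff_christoffel_le hL hP hP' n
  have hl1 := hP'.leadingCoeff_pos n
  have hl2 := hP.leadingCoeff_pos (n + 1)
  have h6 : 0 ≤ x * L (X * P' n * g) := by
    have h7 : (P' n).leadingCoeff / (P (n + 1)).leadingCoeff ≤ 1 := (div_le_one hl2).2 hle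
    have h8 : 1 ≤ (P (n + 1)).leadingCoeff / (P' n).leadingCoeff := (one_le_div hl1).2 hle
    linarith
  have hgpos := functional_sq_pos hL hP hg0
  have h9 : x * x * L (g * g) * ((P' n).eval x * g.eval x) =
      (g.eval x) ^ 2 * (x * L (X * P' n * g)) := by
    linear_combination (-x * g.eval x) * h4
  have h10 : 0 ≤ x * x * L (g * g) * ((P' n).eval x * g.eval x) := by
    rw [h9]
    positivity
  exact nonneg_of_mul_nonneg_right h10 (by positivity)

/-- Partial fractions of `t P' n / P (n + 1)`. -/
theorem exists_partial_fractions (n : ℕ) : ∃ (s : Finset ℝ) (a : ℝ → ℝ),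
    (∀ x ∈ s, 0 < x) ∧ (∀ x ∈ s, 0 ≤ a x) ∧ ∀ t : ℂ, (∀ x ∈ s, t ≠ x) →
      t * aeval t (P' n) = aeval t (P (n + 1)) * ∑ x ∈ s, (a x : ℂ) * (t / (t - x)) := by
  set s := (P (n + 1)).roots.toFinset with hs
  have hval : s.val = (P (n + 1)).roots := by
    rw [hs, Multiset.toFinset_val, Multiset.dedup_eq_self.2 (orthonormal_roots_nodup hL hP _)]
  have hcard : s.card = n + 1 := by
    rw [Finset.card, hval, orthonormal_card_roots hL hP]
  have hP0 : P (n + 1) ≠ 0 := leadingCoeff_ne_zero.1 (hP.leadingCoeff_pos _).ne'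
  have hlc := hP.leadingCoeff_pos (n + 1)
  have hprod : P (n + 1) = C (P (n + 1)).leadingCoeff * ∏ x ∈ s, (X - C x) := by
    have h := C_leadingCoeff_mul_prod_multiset_X_sub_C (p := P (n + 1))
      (by rw [orthonormal_card_roots hL hP, hP.natDegree_eq])
    rw [← hval] at h
    exact h.symm
  have hroot : ∀ x ∈ s, (P (n + 1)).eval x = 0 := by
    intro x hx
    rw [hs, Multiset.mem_toFinset, mem_roots hP0] at hx
    exact hx
  refine ⟨s, fun x => (P' n).eval x * ((∏ y ∈ s.erase x, (x - y))⁻¹ /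
    (P (n + 1)).leadingCoeff), fun x hx => orthonormal_root_pos hL hP (hroot x hx),
    fun x hx => ?_, fun t ht => ?_⟩
  · set g := C (P (n + 1)).leadingCoeff * ∏ y ∈ s.erase x, (X - C y) with hg
    have h1 : P (n + 1) = (X - C x) * g := by
      rw [hg]
      conv_lhs => rw [hprod, ← Finset.mul_prod_erase s _ hx]
      ring
    have h2 := eval_christoffel_mul_nonneg hL hP hP' h1
    have h3 : g.eval x = (P (n + 1)).leadingCoeff * ∏ y ∈ s.erase x, (x - y) := by
      rw [hg, eval_mul, eval_C, eval_prod]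
      simp
    rw [h3] at h2
    set D := ∏ y ∈ s.erase x, (x - y) with hD
    -- Inverting `g (x)` does not change its sign: the coefficient is the nonnegative product times
    -- squares.
    have e : (P' n).eval x * (D⁻¹ / (P (n + 1)).leadingCoeff) =
        ((P' n).eval x * ((P (n + 1)).leadingCoeff * D)) *
          ((P (n + 1)).leadingCoeff⁻¹ ^ 2 * D⁻¹ ^ 2) := by
      rcases eq_or_ne D 0 with h0 | h0
      · rw [h0]; simp
      · field_simp
    simp only
    rw [e]
    positivity
  · have hdeg : ((P' n).map (algebraMap ℝ ℂ)).degree < s.card := by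
      rw [degree_map, hP'.degree_eq, hcard]
      exact_mod_cast Nat.lt_succ_self n
    have hinj : Set.InjOn (fun x : ℝ => (x : ℂ)) s := Complex.ofReal_injective.injOn
    -- The partial fractions are Lagrange interpolation of `P' n`, of degree `n`, at the `n + 1`
    -- zeros of `P (n+1)`.
    have hint := Lagrange.eq_interpolate hinj hdeg
    have hev := congrArg (eval t) hint
    rw [Lagrange.eval_interpolate_not_at_node _ (fun x hx => ht x hx), Lagrange.eval_nodal,
      eval_map_algebraMap] at hev
    have hPt : aeval t (P (n + 1)) = ((P (n + 1)).leadingCoeff : ℂ) * ∏ x ∈ s, (t - (x : ℂ)) := by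
      conv_lhs => rw [hprod]
      simp
    rw [hev, hPt]
    have hlc' : ((P (n + 1)).leadingCoeff : ℂ) ≠ 0 := by exact_mod_cast hlc.ne'
    rw [mul_left_comm, mul_comm _ (∏ x ∈ s, (t - (x : ℂ))), mul_assoc]
    congr 1
    rw [Finset.mul_sum, Finset.mul_sum]
    refine Finset.sum_congr rfl fun x hx => ?_
    have h5 : eval (x : ℂ) ((P' n).map (algebraMap ℝ ℂ)) = (((P' n).eval x : ℝ) : ℂ) := by
      rw [eval_map_algebraMap, ← Complex.coe_algebraMap, aeval_algebraMap_apply, coe_aeval_eq_eval]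
    rw [h5]
    unfold Lagrange.nodalWeight
    push_cast
    rw [Finset.prod_inv_distrib]
    field_simp

-- The left side is the value of `t / (t - x)` at `t = -ρ`. For general `t`, `|t - x|²` times the
-- combination of real and imaginary parts equals `|t|² + x (2 |Im t| - Re t)`. The weight `2` keeps
-- the bracket at least `|t| / 2` up to the boundary of the sector. Linearity in `t / (t - x)`
-- allows summation over the poles.
omit hL hP hP' in
theorem sector_term_bound {t : ℂ} (ht : t.re ≤ |t.im|) {ρ x : ℝ} (hρ : 0 < ρ) (hρt : ρ ≤ ‖t‖)
    (hx : 0 < x) : ρ / (ρ + x) ≤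
      2 * ((t / (t - x)).re - 2 * (if 0 ≤ t.im then 1 else -1) * (t / (t - x)).im) := by
  have hn : 0 < ‖t‖ := hρ.trans_le hρt
  have hσ : (if 0 ≤ t.im then (1 : ℝ) else -1) * t.im = |t.im| := by
    split_ifs with h
    · rw [abs_of_nonneg h, one_mul]
    · rw [abs_of_neg (not_le.1 h)]; ring
  have hne : t - x ≠ 0 := by
    intro h0
    have htx : t = x := sub_eq_zero.1 h0
    rw [htx] at ht
    simp at ht
    linarith
  have hN : 0 < Complex.normSq (t - x) := Complex.normSq_pos.2 hne
  set σ := (if 0 ≤ t.im then (1 : ℝ) else -1) with hσd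
  have e1 : (t / (t - x)).re - 2 * σ * (t / (t - x)).im =
      (‖t‖ ^ 2 + x * (2 * |t.im| - t.re)) / Complex.normSq (t - x) := by
    rw [Complex.div_re, Complex.div_im, Complex.sq_norm, Complex.normSq_apply t]
    simp only [Complex.sub_re, Complex.ofReal_re, Complex.sub_im, Complex.ofReal_im, sub_zero]
    rw [← hσ]
    field_simp
    ring
  have e2 : ‖t‖ ≤ 2 * (2 * |t.im| - t.re) := by
    have h1 := Complex.norm_le_abs_re_add_abs_im t
    rcases abs_cases t.re with ⟨h2, -⟩ | ⟨h2, -⟩ <;> nlinarith [abs_nonneg t.im]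
  have e3 : Complex.normSq (t - x) ≤ (‖t‖ + x) ^ 2 := by
    rw [← Complex.sq_norm]
    have := norm_sub_le t (x : ℂ)
    rw [Complex.norm_real, Real.norm_eq_abs, abs_of_pos hx] at this
    gcongr
  rw [e1]
  have e4 : ρ / (ρ + x) ≤ ‖t‖ / (‖t‖ + x) := by
    rw [div_le_div_iff₀ (by linarith) (by linarith)]
    nlinarith
  refine e4.trans ?_
  rw [← mul_div_assoc, div_le_div_iff₀ (by linarith) hN]
  calc ‖t‖ * Complex.normSq (t - x) ≤ ‖t‖ * (‖t‖ + x) ^ 2 := by gcongr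
    _ = (‖t‖ * (‖t‖ + x)) * (‖t‖ + x) := by ring
    _ ≤ _ := by
      refine mul_le_mul_of_nonneg_right ?_ (by linarith)
      nlinarith

/-- In the sector `Re t ≤ |Im t|`, the polynomial `t P' n` dominates `P (n + 1)`. -/
theorem norm_orthonormal_le_sector (n : ℕ) {t : ℂ} (ht : t.re ≤ |t.im|) {ρ : ℝ} (hρ : 0 < ρ)
    (hρt : ρ ≤ ‖t‖) :
    ‖aeval t (P (n + 1))‖ * (ρ * ‖aeval (-ρ : ℂ) (P' n)‖) ≤
      6 * ‖aeval (-ρ : ℂ) (P (n + 1))‖ * ‖t * aeval t (P' n)‖ := by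
  obtain ⟨s, a, hs, ha, hfrac⟩ := exists_partial_fractions hL hP hP' n
  have h1 := hfrac t fun x hx h0 => by
    rw [h0] at ht
    simp at ht
    linarith [hs x hx]
  have h2 := hfrac (-ρ) fun x hx h0 => by
    have h3 : -ρ = x := by exact_mod_cast h0
    linarith [hs x hx]
  have h3 : (∑ x ∈ s, (a x : ℂ) * ((-ρ : ℂ) / (-ρ - x))) =
      ((∑ x ∈ s, a x * (ρ / (ρ + x)) : ℝ) : ℂ) := by
    push_cast
    refine Finset.sum_congr rfl fun x hx => ?_
    rw [← neg_div_neg_eq (-ρ : ℂ)]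
    congr 2
    · ring
    · ring
  rw [h3] at h2
  set S := ∑ x ∈ s, a x * (ρ / (ρ + x)) with hS
  have hS0 : 0 ≤ S := Finset.sum_nonneg fun x hx =>
    mul_nonneg (ha x hx) (div_nonneg hρ.le (by linarith [hs x hx]))
  set U := ∑ x ∈ s, (a x : ℂ) * (t / (t - x)) with hU
  -- Here `6 = 2 (1 + 2)`: the factor `2` of the termwise bound times the weights of `|Re U|` and
  -- `|Im U|`.
  have h4 : S ≤ 6 * ‖U‖ := by
    set σ := (if 0 ≤ t.im then (1 : ℝ) else -1) with hσ
    have h5 : S ≤ 2 * (U.re - 2 * σ * U.im) := by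
      rw [hS, hU, Complex.re_sum, Complex.im_sum, Finset.mul_sum, ← Finset.sum_sub_distrib,
        Finset.mul_sum]
      refine Finset.sum_le_sum fun x hx => ?_
      have := mul_le_mul_of_nonneg_left (sector_term_bound ht hρ hρt (hs x hx)) (ha x hx)
      rw [Complex.re_ofReal_mul, Complex.im_ofReal_mul]
      linarith
    have h6 := Complex.abs_re_le_norm U
    have h7 := Complex.abs_im_le_norm U
    have h8 := abs_le.1 h6
    have h9 := abs_le.1 h7
    rcases ite_eq_or_eq (0 ≤ t.im) (1 : ℝ) (-1) with h | h <;> rw [← hσ] at h <;> rw [h] at h5 <;>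
      linarith [h8.2, h9.1, h9.2]
  have h5 := congrArg norm h2
  rw [norm_mul, norm_neg, Complex.norm_real, Real.norm_eq_abs, abs_of_pos hρ, norm_mul,
    Complex.norm_real, Real.norm_eq_abs, abs_of_nonneg hS0] at h5
  rw [h5, h1, norm_mul]
  have := mul_le_mul_of_nonneg_left h4
    (mul_nonneg (norm_nonneg (aeval t (P (n + 1)))) (norm_nonneg (aeval (-ρ : ℂ) (P (n + 1)))))
  linarith

end Functional

/-! ### The connection formula and the linear system for the coefficients at the edge -/

/-- A polynomial orthogonal to `X^R h` for all `h` of degree less than `n - R` is a combination of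
the `X^j P j (n - j)`. -/
theorem exists_eq_sum_X_pow_mul {R : ℕ} {L : ℝ[X] →ₗ[ℝ] ℝ} (hL : NonnegFunctional L)
    {P : ℕ → ℕ → ℝ[X]}
    (hP : ∀ j ≤ R, IsOrthonormalPolynomials (fun f g => polyForm (shiftFunctional L j) f g) (P j))
    {n : ℕ} {f : ℝ[X]} (hn : R ≤ n) (hf : f.degree < (n + 1 : ℕ))
    (horth : ∀ h : ℝ[X], h.degree < (n - R : ℕ) → L (f * (X ^ R * h)) = 0) :
    ∃ lam : ℕ → ℝ, f = ∑ j ∈ Finset.range (R + 1), lam j • (X ^ j * P j (n - j)) := by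
  induction R generalizing L P n f with
  | zero =>
    have hP0 := hP 0 le_rfl
    rw [shiftFunctional_zero] at hP0
    refine ⟨fun _ => polyForm L f (P 0 n), ?_⟩
    have h := hP0.eq_sum_of_degree_lt hf
    rw [Finset.sum_range_succ, Finset.sum_eq_zero, zero_add] at h
    · simpa using h
    · intro k hk
      have := horth (P 0 k) (by
        rw [hP0.degree_eq]
        exact_mod_cast (by simpa using hk : k < n - 0))
      rw [pow_zero, one_mul] at this
      rw [polyForm_apply, this, zero_smul]
  | succ R ih =>
    have hP0 := hP 0 (Nat.zero_le _)
    rw [shiftFunctional_zero] at hP0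
    have hz := orthonormal_eval_zero_ne_zero hL hP0 n
    -- Subtracting `l₀ P 0 n` creates a zero at `0`, which is possible because `P 0 n` does not
    -- vanish there. The quotient by `X` satisfies the same orthogonality for `x² L` with `R` and
    -- `n` lowered by one.
    set l₀ := f.eval 0 / (P 0 n).eval 0 with hl₀
    obtain ⟨f₁, hf₁⟩ : X ∣ f - l₀ • P 0 n := by
      rw [X_dvd_iff, coeff_zero_eq_eval_zero, eval_sub, eval_smul, smul_eq_mul, hl₀,
        div_mul_cancel₀ _ hz, sub_self]
    have hd₁ : f₁.degree < (n - 1 + 1 : ℕ) := by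
      rw [degree_lt_iff_coeff_zero] at hf ⊢
      intro m hm
      have hc := congrArg (fun p => coeff p (m + 1)) hf₁
      simp only [coeff_X_mul, coeff_sub, coeff_smul] at hc
      rw [← hc, hf _ (by lia),
        coeff_eq_zero_of_natDegree_lt (by rw [hP0.natDegree_eq]; lia)]
      simp
    obtain ⟨lam, hlam⟩ := ih (hL.shift 1) (P := fun j => P (j + 1)) (n := n - 1) (f := f₁)
      (fun j hj => by
        rw [shiftFunctional_shiftFunctional, add_comm 1 j]
        exact hP (j + 1) (by lia)) (by lia) hd₁ (fun h hh => by
        rw [shiftFunctional_apply]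
        have e : X ^ (2 * 1) * (f₁ * (X ^ R * h)) = f * (X ^ (R + 1) * h) -
            l₀ • (P 0 n * (X ^ (R + 1) * h)) := by
          have : f = X * f₁ + l₀ • P 0 n := by rw [← hf₁]; abel
          rw [this, smul_eq_C_mul, smul_eq_C_mul]
          ring
        have e' : n - 1 - R = n - (R + 1) := by lia
        rw [e'] at hh
        have h2 : degree (X ^ (R + 1) * h) < ((n : ℕ) : WithBot ℕ) := by
          rw [degree_lt_iff_coeff_zero] at hh ⊢
          intro m hm
          rw [coeff_X_pow_mul', if_pos (by lia), hh _ (by lia)]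
        have h3 := (hP0.apply_of_degree_lt h2).1
        rw [polyForm_apply] at h3
        rw [e, map_sub, map_smul, h3, horth h hh, smul_zero, sub_zero])
    refine ⟨fun j => Nat.casesOn j l₀ lam, ?_⟩
    have hfe : f = X * f₁ + l₀ • P 0 n := by rw [← hf₁]; abel
    rw [Finset.sum_range_succ', hfe, hlam, Finset.mul_sum]
    simp only [pow_zero, one_mul, Nat.sub_zero]
    congr 1
    refine Finset.sum_congr rfl fun j _ => ?_
    have e : n - 1 - j = n - (j + 1) := by lia
    rw [e, pow_succ, smul_eq_C_mul, smul_eq_C_mul]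
    ring

/-- A Cauchy matrix with nonzero row and column scaling is invertible. -/
theorem cauchy_det_ne_zero {r : ℕ} {κ : ℕ → ℝ} (hκ : ∀ i ≤ r, κ i ≠ 0) {e b : ℝ} (he : 0 < e)
    (hb : 0 < b) :
    (Matrix.of fun l i : Fin (r + 1) =>
      κ l * κ i / (b * (e + (l : ℕ) + (i : ℕ)))).det ≠ 0 := by
  intro hdet
  obtain ⟨v, hv, hv0⟩ := Matrix.exists_mulVec_eq_zero_iff.2 hdet
  refine hv ?_
  have hsum : ∀ l : Fin (r + 1), ∑ i : Fin (r + 1), κ i * v i / (e + (l : ℕ) + (i : ℕ)) = 0 := by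
    intro l
    have h1 := congrFun hv0 l
    simp only [Matrix.mulVec, dotProduct, Matrix.of_apply, Pi.zero_apply] at h1
    have h2 : ∑ i : Fin (r + 1), κ l * κ i / (b * (e + (l : ℕ) + (i : ℕ))) * v i =
        κ l / b * ∑ i : Fin (r + 1), κ i * v i / (e + (l : ℕ) + (i : ℕ)) := by
      rw [Finset.mul_sum]
      refine Finset.sum_congr rfl fun i _ => ?_
      have : e + (l : ℕ) + (i : ℕ) ≠ 0 := by positivity
      field_simp
    rw [h2] at h1
    exact (mul_eq_zero.1 h1).resolve_left
      (div_ne_zero (hκ l (Nat.lt_succ_iff.1 l.2)) hb.ne')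
  -- A kernel vector gives a rational function vanishing at `0, …, r`. Its numerator `N` has degree
  -- at most `r`, hence is zero, and evaluation at the pole `-(e + i)` isolates the entry `v i`.
  set N : ℝ[X] := ∑ i : Fin (r + 1), C (κ i * v i) *
    ∏ m ∈ Finset.univ.erase i, (X + C (e + ((m : Fin (r + 1)) : ℕ))) with hN
  have hN0 : N = 0 := by
    refine eq_zero_of_natDegree_lt_card_of_eval_eq_zero N (f := fun l : Fin (r + 1) => ((l : ℕ) : ℝ))
      (fun x y hxy => Fin.ext (Nat.cast_injective hxy)) (fun l => ?_) ?_
    · rw [hN, eval_finsetSum]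
      have h3 : ∀ i : Fin (r + 1), eval ((l : ℕ) : ℝ) (C (κ i * v i) *
          ∏ m ∈ Finset.univ.erase i, (X + C (e + ((m : Fin (r + 1)) : ℕ)))) =
          (∏ m : Fin (r + 1), (e + (l : ℕ) + (m : ℕ))) *
            (κ i * v i / (e + (l : ℕ) + (i : ℕ))) := by
        intro i
        have : e + (l : ℕ) + (i : ℕ) ≠ 0 := by positivity
        rw [eval_mul, eval_C, eval_prod, ← Finset.mul_prod_erase Finset.univ _ (Finset.mem_univ i)]
        have h4 : ∏ m ∈ Finset.univ.erase i, eval ((l : ℕ) : ℝ) (X + C (e + ((m : Fin (r + 1)) : ℕ)))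
            = ∏ m ∈ Finset.univ.erase i, (e + (l : ℕ) + ((m : Fin (r + 1)) : ℕ)) :=
          Finset.prod_congr rfl fun m _ => by
            rw [eval_add, eval_X, eval_C]; ring
        rw [h4]
        field_simp
      rw [Finset.sum_congr rfl fun i _ => h3 i, ← Finset.mul_sum, hsum l, mul_zero]
    · rw [Fintype.card_fin, Nat.lt_succ_iff, hN]
      refine natDegree_sum_le_of_forall_le _ _ fun i _ => ?_
      refine (natDegree_C_mul_le _ _).trans ((natDegree_prod_le _ _).trans ?_)
      refine (Finset.sum_le_card_nsmul _ _ 1 fun m _ => ?_).trans ?_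
      · exact (natDegree_X_add_C _).le
      · simp
  funext i
  have h5 := congrArg (eval (-(e + (i : ℕ)))) hN0
  rw [hN, eval_finsetSum, Finset.sum_eq_single i, eval_mul, eval_C, eval_prod, eval_zero,
    mul_eq_zero] at h5
  · rcases h5 with h5 | h5
    · exact (mul_eq_zero.1 h5).resolve_left (hκ i (Nat.lt_succ_iff.1 i.2))
    · obtain ⟨m, hm, hm0⟩ := Finset.prod_eq_zero_iff.1 h5
      rw [eval_add, eval_X, eval_C] at hm0
      have h6 : ((m : ℕ) : ℝ) = (i : ℕ) := by linarith
      exact absurd (Fin.ext (by exact_mod_cast h6)) (Finset.ne_of_mem_erase hm)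
  · intro j _ hj
    rw [eval_mul, eval_prod, Finset.prod_eq_zero (Finset.mem_erase.2 ⟨hj.symm, Finset.mem_univ i⟩),
      mul_zero]
    rw [eval_add, eval_X, eval_C]
    ring
  · exact fun h => absurd (Finset.mem_univ i) h

/-- Summation of regularly growing sequences. -/
theorem tendsto_sum_range_div_rpow {x : ℕ → ℝ} {ℓ e : ℝ} (he : 0 < e)
    (hx : Tendsto (fun n : ℕ => x n / (n : ℝ) ^ (e - 1)) atTop (𝓝 ℓ)) :
    Tendsto (fun n : ℕ => (∑ k ∈ Finset.range n, x k) / (n : ℝ) ^ e) atTop (𝓝 (ℓ / e)) := by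
  -- The comparison sequence telescopes to `n^e` and is asymptotic to `e k^(e-1)`; the error `x -
  -- (ℓ/e) g` is `o(g)`, which survives summation as `∑ g` diverges.
  set g : ℕ → ℝ := fun k => ((k + 1 : ℕ) : ℝ) ^ e - (k : ℝ) ^ e with hg
  have hg0 : ∀ k, 0 < g k := fun k => by
    rw [hg]
    exact sub_pos.2 (Real.rpow_lt_rpow k.cast_nonneg (by push_cast; linarith) he)
  have hgsum : ∀ n, ∑ k ∈ Finset.range n, g k = (n : ℝ) ^ e := fun n => by
    rw [hg, Finset.sum_range_sub (fun k : ℕ => (k : ℝ) ^ e)]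
    simp [Real.zero_rpow he.ne']
  have hglim : Tendsto (fun n : ℕ => g n / (n : ℝ) ^ (e - 1)) atTop (𝓝 e) := by
    have hd : HasDerivAt (fun t : ℝ => t ^ e) e 1 := by
      simpa using Real.hasDerivAt_rpow_const (x := 1) (p := e) (Or.inl one_ne_zero)
    have h1 := hasDerivAt_iff_tendsto_slope_zero.1 hd
    have h2 : Tendsto (fun n : ℕ => ((n : ℝ))⁻¹) atTop (𝓝[≠] 0) := by
      refine tendsto_nhdsWithin_iff.2 ⟨tendsto_inv_atTop_nhds_zero_nat, ?_⟩
      filter_upwards [eventually_gt_atTop 0] with n hn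
      exact inv_ne_zero (by exact_mod_cast hn.ne')
    refine (h1.comp h2).congr' ?_
    filter_upwards [eventually_gt_atTop 0] with n hn
    have hn' : (0 : ℝ) < n := by exact_mod_cast hn
    simp only [Function.comp_apply, inv_inv, smul_eq_mul, Real.one_rpow, hg]
    rw [Real.rpow_sub hn', Real.rpow_one]
    have h3 : (1 + (n : ℝ)⁻¹) = ((n + 1 : ℕ) : ℝ) / n := by
      push_cast
      field_simp
    rw [h3, Real.div_rpow (by positivity) hn'.le]
    have : (0 : ℝ) < (n : ℝ) ^ e := Real.rpow_pos_of_pos hn' e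
    field_simp
  have hfo : (fun k => x k - ℓ / e * g k) =o[atTop] g := by
    rw [Asymptotics.isLittleO_iff_tendsto fun k hk => absurd hk (hg0 k).ne']
    have h1 := (hx.div hglim he.ne').sub (tendsto_const_nhds (x := ℓ / e))
    rw [sub_self] at h1
    refine h1.congr' ?_
    filter_upwards [eventually_gt_atTop 0] with n hn
    have hn' : (0 : ℝ) < n := by exact_mod_cast hn
    have h4 : (0 : ℝ) < (n : ℝ) ^ (e - 1) := Real.rpow_pos_of_pos hn' _
    have h5 := hg0 n
    simp only [Pi.div_apply]
    field_simp
  have hs := hfo.sum_range (fun k => (hg0 k).le) (by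
    simp only [hgsum]
    exact (tendsto_rpow_atTop he).comp tendsto_natCast_atTop_atTop)
  simp only [hgsum] at hs
  have h6 := hs.tendsto_div_nhds_zero.add (tendsto_const_nhds (x := ℓ / e))
  rw [zero_add] at h6
  refine h6.congr' ?_
  filter_upwards [eventually_gt_atTop 0] with n hn
  have hn' : (0 : ℝ) < n := by exact_mod_cast hn
  have h4 : (0 : ℝ) < (n : ℝ) ^ e := Real.rpow_pos_of_pos hn' _
  rw [Finset.sum_sub_distrib, ← Finset.mul_sum, hgsum]
  field_simp
  ring

/-- Solutions of `(C_n + E_n) y = u_n` with `C_n + E_n` tending to an invertible matrix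
converge. -/
theorem exists_tendsto_of_mulVec_eq {m : Type*} [Fintype m] [DecidableEq m]
    {Mn : ℕ → Matrix m m ℝ} {M : Matrix m m ℝ} {u y : ℕ → m → ℝ} {u₀ : m → ℝ}
    (hM : Tendsto Mn atTop (𝓝 M)) (hdet : M.det ≠ 0) (hu : Tendsto u atTop (𝓝 u₀))
    (heq : ∀ᶠ n in atTop, (Mn n).mulVec (y n) = u n) : ∃ y₀, Tendsto y atTop (𝓝 y₀) := by
  have cd : Continuous fun N : Matrix m m ℝ => N.det := Continuous.matrix_det continuous_id
  have ca : Continuous fun N : Matrix m m ℝ => N.adjugate :=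
    Continuous.matrix_adjugate continuous_id
  have hd : Tendsto (fun n => (Mn n).det) atTop (𝓝 M.det) := (cd.tendsto M).comp hM
  have ha : Tendsto (fun n => (Mn n).adjugate) atTop (𝓝 M.adjugate) := (ca.tendsto M).comp hM
  have hmv : Tendsto (fun n => (Mn n).adjugate.mulVec (u n)) atTop (𝓝 (M.adjugate.mulVec u₀)) :=
    tendsto_pi_nhds.2 fun i => tendsto_finsetSum _ fun j _ =>
      (tendsto_pi_nhds.1 (tendsto_pi_nhds.1 ha i) j).mul (tendsto_pi_nhds.1 hu j)
  have hlim := (hd.inv₀ hdet).smul hmv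
  have hev : (fun n => ((Mn n).det)⁻¹ • (Mn n).adjugate.mulVec (u n)) =ᶠ[atTop] y := by
    filter_upwards [heq, hd.eventually_ne hdet] with n hn hn0
    rw [← hn, Matrix.mulVec_mulVec, Matrix.adjugate_mul, Matrix.smul_mulVec, Matrix.one_mulVec,
      smul_smul, inv_mul_cancel₀ hn0, one_smul]
  exact ⟨M.det⁻¹ • M.adjugate.mulVec u₀, hlim.congr' hev⟩

/-- The scaled derivatives at the hard edge of the Sobolev polynomials tend to zero. -/
theorem tendsto_scaled_coeff_zero {r : ℕ} {A B a b ν : ℝ} (hA : 0 < A) (hB : 0 < B) (hb : 0 < b)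
    (hν : -1 < ν) (hab : 2 * a + 1 = b * (ν + 1)) {s β : ℕ → ℝ}
    (hs : AsympEq (fun n => (s n)⁻¹) (fun n => A * (n : ℝ) ^ a))
    (hβ : AsympEq β (fun n => B * (n : ℝ) ^ b)) {u v : ℕ → ℕ → ℝ} {d : ℕ → ℝ}
    (hd : ∀ i ≤ r, d i ≠ 0)
    (hu : ∀ i ≤ r, Tendsto (fun n => (-1) ^ n * (s n / β n ^ i) * u i n) atTop (𝓝 (d i)))
    {m : ℕ → ℝ} (hm : ∀ i ≤ r, 0 < m i)
    (hv : ∀ l ≤ r, ∀ n, v l n = u l n - ∑ i ∈ Finset.range (r + 1),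
      m i * v i n * ∑ k ∈ Finset.range n, u l k * u i k) {i : ℕ} (hi : i ≤ r) :
    Tendsto (fun n => (-1) ^ n * (s n / β n ^ i) * v i n) atTop (𝓝 0) := by
  set κ : ℕ → ℝ := fun i => A * B ^ i * d i with hκ
  have hκ0 : ∀ i ≤ r, κ i ≠ 0 := fun i hi => by
    have := hd i hi
    positivity
  have hsne : ∀ᶠ n in atTop, s n ≠ 0 := by
    filter_upwards [hs.eventually_ne one_ne_zero] with n hn h0
    rw [h0] at hn
    simp at hn
  have hβne : ∀ᶠ n in atTop, β n ≠ 0 := by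
    filter_upwards [hβ.eventually_ne one_ne_zero] with n hn h0
    rw [h0] at hn
    simp at hn
  have hpw : ∀ (n : ℕ), 0 < n → ∀ c : ℝ, 0 < (n : ℝ) ^ c := fun n hn c =>
    Real.rpow_pos_of_pos (by exact_mod_cast hn) c
  have hexp : ∀ (n : ℕ), 0 < n → ∀ i : ℕ, (n : ℝ) ^ (a + b * i) = (n : ℝ) ^ a * ((n : ℝ) ^ b) ^ i := by
    intro n hn i
    have hn' : (0 : ℝ) < n := by exact_mod_cast hn
    rw [Real.rpow_add hn', Real.rpow_mul hn'.le, Real.rpow_natCast]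
  have hu' : ∀ i ≤ r, Tendsto (fun n : ℕ => (-1) ^ n * u i n / (n : ℝ) ^ (a + b * i)) atTop
      (𝓝 (κ i)) := by
    intro i hi
    have h1 := (((hu i hi).mul hs).mul (hβ.pow i)).mul_const (A * B ^ i)
    have e : d i * 1 * 1 ^ i * (A * B ^ i) = κ i := by rw [hκ]; ring
    rw [e] at h1
    refine h1.congr' ?_
    filter_upwards [hsne, hβne, eventually_gt_atTop 0] with n h2 h3 hn
    have h4 := hpw n hn a
    have h5 := hpw n hn b
    rw [hexp n hn, div_pow, mul_pow]
    field_simp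
  -- The relation `2 a + 1 = b (ν + 1)` turns the exponent of the sums into `b (ν + 1 + l + i)`,
  -- positive and of Cauchy type.
  have hmat : ∀ l ≤ r, ∀ i ≤ r, Tendsto (fun n : ℕ => (∑ k ∈ Finset.range n, u l k * u i k) /
      (n : ℝ) ^ (b * (ν + 1 + l + i))) atTop (𝓝 (κ l * κ i / (b * (ν + 1 + l + i)))) := by
    intro l hl i hi
    have hpos : 0 < b * (ν + 1 + l + i) := by
      have : 0 < ν + 1 := by linarith
      positivity
    refine tendsto_sum_range_div_rpow hpos ?_
    refine ((hu' l hl).mul (hu' i hi)).congr' ?_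
    filter_upwards [eventually_gt_atTop 0] with n hn
    have hn' : (0 : ℝ) < n := by exact_mod_cast hn
    have e : b * (ν + 1 + l + i) - 1 = (a + b * l) + (a + b * i) := by linarith
    rw [e, Real.rpow_add hn' (a + b * l), div_mul_div_comm]
    congr 1
    have : ((-1 : ℝ) ^ n) * (-1) ^ n = 1 := by rw [← mul_pow]; simp
    linear_combination (u l n * u i n) * this
  -- In these unknowns the system has a convergent matrix; the identity part of the original system
  -- becomes a diagonal term tending to `0`.
  set y : ℕ → Fin (r + 1) → ℝ := fun n i =>
    m i * (n : ℝ) ^ (b * (ν + 1 + (i : ℕ) + (i : ℕ))) *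
      ((-1) ^ n * v i n / (n : ℝ) ^ (a + b * (i : ℕ))) with hy
  have hinv : ∀ i ≤ r, Tendsto (fun n : ℕ => (m i * (n : ℝ) ^ (b * (ν + 1 + i + i)))⁻¹) atTop
      (𝓝 0) := by
    intro i hi
    have hpos : 0 < b * (ν + 1 + i + i) := by
      have : 0 < ν + 1 := by linarith
      positivity
    exact (((tendsto_rpow_atTop hpos).comp tendsto_natCast_atTop_atTop).const_mul_atTop
      (hm i hi)).inv_tendsto_atTop
  obtain ⟨y₀, hy₀⟩ : ∃ y₀, Tendsto y atTop (𝓝 y₀) := by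
    refine exists_tendsto_of_mulVec_eq (Mn := fun n => Matrix.of fun l i : Fin (r + 1) =>
      (∑ k ∈ Finset.range n, u l k * u i k) / (n : ℝ) ^ (b * (ν + 1 + (l : ℕ) + (i : ℕ))) +
        if l = i then (m i * (n : ℝ) ^ (b * (ν + 1 + (i : ℕ) + (i : ℕ))))⁻¹ else 0)
      (u := fun n l => (-1) ^ n * u l n / (n : ℝ) ^ (a + b * (l : ℕ))) (u₀ := fun l => κ l)
      ?_ (cauchy_det_ne_zero hκ0 (show 0 < ν + 1 by linarith) hb)
      (tendsto_pi_nhds.2 fun l => hu' l (Nat.lt_succ_iff.1 l.2)) ?_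
    · refine tendsto_pi_nhds.2 fun l => tendsto_pi_nhds.2 fun i => ?_
      have h1 := hmat l (Nat.lt_succ_iff.1 l.2) i (Nat.lt_succ_iff.1 i.2)
      have h2 : Tendsto (fun n : ℕ => if l = i then
          (m i * (n : ℝ) ^ (b * (ν + 1 + (i : ℕ) + (i : ℕ))))⁻¹ else 0) atTop (𝓝 0) := by
        split_ifs
        · exact hinv i (Nat.lt_succ_iff.1 i.2)
        · exact tendsto_const_nhds
      simpa using h1.add h2
    · filter_upwards [eventually_gt_atTop 0] with n hn
      have hn' : (0 : ℝ) < n := by exact_mod_cast hn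
      funext l
      simp only [Matrix.mulVec, dotProduct, Matrix.of_apply, add_mul, ite_mul, zero_mul,
        Finset.sum_add_distrib, Finset.sum_ite_eq, Finset.mem_univ, if_true]
      have hl := hv l (Nat.lt_succ_iff.1 l.2) n
      rw [← Fin.sum_univ_eq_sum_range
        (fun i => m i * v i n * ∑ k ∈ Finset.range n, u l k * u i k) (r + 1)] at hl
      have h1 : (m l * (n : ℝ) ^ (b * (ν + 1 + (l : ℕ) + (l : ℕ))))⁻¹ * y n l =
          (-1) ^ n * v l n / (n : ℝ) ^ (a + b * (l : ℕ)) := by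
        have := (hm l (Nat.lt_succ_iff.1 l.2)).ne'
        have := (hpw n hn (b * (ν + 1 + (l : ℕ) + (l : ℕ)))).ne'
        rw [hy]
        exact inv_mul_cancel_left₀ (by positivity) _
      have h2 : ∀ i : Fin (r + 1), (∑ k ∈ Finset.range n, u l k * u i k) /
          (n : ℝ) ^ (b * (ν + 1 + (l : ℕ) + (i : ℕ))) * y n i =
          (-1) ^ n / (n : ℝ) ^ (a + b * (l : ℕ)) *
            (m i * v i n * ∑ k ∈ Finset.range n, u l k * u i k) := by
        intro i
        have e1 : (n : ℝ) ^ (b * (ν + 1 + (i : ℕ) + (i : ℕ))) * (n : ℝ) ^ (a + b * (l : ℕ)) =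
            (n : ℝ) ^ (b * (ν + 1 + (l : ℕ) + (i : ℕ))) * (n : ℝ) ^ (a + b * (i : ℕ)) := by
          rw [← Real.rpow_add hn', ← Real.rpow_add hn']
          congr 1
          ring
        have p1 := hpw n hn (b * (ν + 1 + (l : ℕ) + (i : ℕ)))
        have p2 := hpw n hn (a + b * (i : ℕ))
        have p3 := hpw n hn (a + b * (l : ℕ))
        simp only [hy]
        rw [div_mul_eq_mul_div, div_mul_eq_mul_div, mul_div_assoc', mul_div_assoc', div_div,
          div_eq_div_iff (by positivity) (by positivity)]
        linear_combination ((∑ k ∈ Finset.range n, u l k * u i k) * m i * (-1) ^ n * v i n) * e1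
      rw [Finset.sum_congr rfl fun i _ => h2 i, ← Finset.mul_sum, h1, hl]
      ring
  -- Boundedness of `y` gains a factor `n^(-b (ν + 1 + 2 i))` for `v` over the natural size `n^(a +
  -- b i)` of `u`.
  have hyi := (tendsto_pi_nhds.1 hy₀ ⟨i, Nat.lt_succ_iff.2 hi⟩).mul (hinv i hi)
  rw [mul_zero] at hyi
  have h7 := (hyi.div hs one_ne_zero).div (hβ.pow i) (by simp)
  have h8 := h7.div_const (A * B ^ i)
  simp only [zero_div] at h8
  refine h8.congr' ?_
  filter_upwards [hsne, hβne, eventually_gt_atTop 0] with n h2 h3 hn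
  have h4 := hpw n hn a
  have h5 := hpw n hn b
  have h6 := hpw n hn (b * (ν + 1 + i + i))
  have h9 := hm i hi
  simp only [hy, Pi.div_apply]
  rw [hexp n hn, div_pow, mul_pow]
  field_simp

/-! ### Asymptotics of the systems `P j` at the hard edge -/

theorem AsympEq.eventually_ne_zero {x y : ℕ → ℝ} (h : AsympEq x y) : ∀ᶠ n in atTop, x n ≠ 0 := by
  filter_upwards [h.eventually_ne one_ne_zero] with n hn h0
  rw [h0, zero_div] at hn
  exact hn rfl

theorem AsympEq.eventually_pos {x : ℕ → ℝ} {D e : ℝ} (hD : 0 < D)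
    (h : AsympEq x fun n => D * (n : ℝ) ^ e) : ∀ᶠ n in atTop, 0 < x n := by
  filter_upwards [h.eventually_const_lt one_pos, eventually_gt_atTop 0] with n hn hn0
  have : 0 < D * (n : ℝ) ^ e := mul_pos hD (Real.rpow_pos_of_pos (by exact_mod_cast hn0) e)
  exact (div_pos_iff_of_pos_right this).1 hn

theorem AsympEq.tendsto_sub_div {x : ℕ → ℝ} {D e : ℝ} (hD : 0 < D)
    (h : AsympEq x fun n => D * (n : ℝ) ^ e) (j : ℕ) :
    Tendsto (fun n => x (n - j) / x n) atTop (𝓝 1) := by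
  have h1 : Tendsto (fun n : ℕ => (((n - j : ℕ) : ℝ) / n) ^ e) atTop (𝓝 1) := by
    have h2 : Tendsto (fun n : ℕ => ((n - j : ℕ) : ℝ) / n) atTop (𝓝 1) := by
      have h3 := (tendsto_const_nhds (x := (1 : ℝ))).sub
        (tendsto_inv_atTop_nhds_zero_nat (𝕜 := ℝ) |>.const_mul (j : ℝ))
      rw [mul_zero, sub_zero] at h3
      refine h3.congr' ?_
      filter_upwards [eventually_ge_atTop j, eventually_gt_atTop 0] with n hn hn0
      have : (n : ℝ) ≠ 0 := by exact_mod_cast hn0.ne'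
      rw [Nat.cast_sub hn]
      field_simp
    have h4 := (Real.continuousAt_rpow_const 1 e (Or.inl one_ne_zero)).tendsto.comp h2
    rw [Real.one_rpow] at h4
    exact h4
  have h5 := ((h.comp (tendsto_sub_atTop_nat j)).div h one_ne_zero).mul h1
  rw [div_one, mul_one] at h5
  refine h5.congr' ?_
  filter_upwards [eventually_gt_atTop j] with n hn
  have p1 : (0 : ℝ) < n := by exact_mod_cast (by lia : 0 < n)
  have p2 : (0 : ℝ) < (n - j : ℕ) := by exact_mod_cast (by lia : 0 < n - j)
  have q1 := Real.rpow_pos_of_pos p1 e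
  have q2 := Real.rpow_pos_of_pos p2 e
  simp only [Pi.div_apply, Function.comp_apply]
  rw [Real.div_rpow p2.le p1.le]
  field_simp

/-- The discrete Sobolev form of `L` in terms of Taylor coefficients at the origin. -/
noncomputable def coeffSobolevForm (L : ℝ[X] →ₗ[ℝ] ℝ) (r : ℕ) (m : ℕ → ℝ) :
    ℝ[X] →ₗ[ℝ] ℝ[X] →ₗ[ℝ] ℝ :=
  polyForm L + ∑ i ∈ Finset.range (r + 1),
    m i • (LinearMap.mul ℝ ℝ).compl₁₂ (lcoeff ℝ i) (lcoeff ℝ i)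

theorem coeffSobolevForm_apply (L : ℝ[X] →ₗ[ℝ] ℝ) (r : ℕ) (m : ℕ → ℝ) (f g : ℝ[X]) :
    coeffSobolevForm L r m f g =
      L (f * g) + ∑ i ∈ Finset.range (r + 1), m i * (f.coeff i * g.coeff i) := by
  simp [coeffSobolevForm, LinearMap.sum_apply]

/-- Orthonormal polynomials for `x^(2 j) dμ` with Mehler–Heine asymptotics of Bessel type at the
hard edge `0`. -/
structure HardEdgeSystem (L : ℝ[X] →ₗ[ℝ] ℝ) (P : ℕ → ℕ → ℝ[X]) (r : ℕ) (s β : ℕ → ℝ)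
    (A B a b ν : ℝ) : Prop where
  nonneg : NonnegFunctional L
  orthonormal : ∀ j ≤ r + 1,
    IsOrthonormalPolynomials (fun f g => polyForm (shiftFunctional L j) f g) (P j)
  A_pos : 0 < A
  B_pos : 0 < B
  b_pos : 0 < b
  neg_one_lt : -1 < ν
  exponents : 2 * a + 1 = b * (ν + 1)
  asymp_s : AsympEq (fun n => (s n)⁻¹) (fun n => A * (n : ℝ) ^ a)
  asymp_β : AsympEq β (fun n => B * (n : ℝ) ^ b)
  conv : ∀ j ≤ r + 1, ContConv
    (fun n w => (-1) ^ n * ((s n / β n ^ j : ℝ) : ℂ) * aeval (w / (β n : ℂ)) (P j n))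
    (phi (ν + 2 * j))

namespace HardEdgeSystem

variable {L : ℝ[X] →ₗ[ℝ] ℝ} {P : ℕ → ℕ → ℝ[X]} {r : ℕ} {s β : ℕ → ℝ} {A B a b ν : ℝ}
  (h : HardEdgeSystem L P r s β A B a b ν)
include h

theorem eventually_s_ne : ∀ᶠ n in atTop, s n ≠ 0 := by
  filter_upwards [h.asymp_s.eventually_ne_zero] with n hn
  exact fun h0 => hn (by rw [h0, inv_zero])

theorem eventually_β_pos : ∀ᶠ n in atTop, 0 < β n := h.asymp_β.eventually_pos h.B_pos

theorem tendsto_s_ratio (j : ℕ) : Tendsto (fun n => s n / s (n - j)) atTop (𝓝 1) := by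
  refine (h.asymp_s.tendsto_sub_div h.A_pos j).congr fun n => ?_
  rw [inv_div_inv]

theorem tendsto_β_ratio (j : ℕ) : Tendsto (fun n => β (n - j) / β n) atTop (𝓝 1) :=
  h.asymp_β.tendsto_sub_div h.B_pos j

theorem order_gt (j : ℕ) : -1 < ν + 2 * j := by
  have := h.neg_one_lt
  have : (0 : ℝ) ≤ j := j.cast_nonneg
  linarith

theorem orthonormal_zero : IsOrthonormalPolynomials (fun f g => polyForm L f g) (P 0) := by
  have := h.orthonormal 0 (Nat.zero_le _)
  rwa [shiftFunctional_zero] at this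

theorem orthonormal_succ {j : ℕ} (hj : j ≤ r) : IsOrthonormalPolynomials
    (fun f g => polyForm (shiftFunctional (shiftFunctional L j) 1) f g) (P (j + 1)) := by
  rw [shiftFunctional_shiftFunctional]
  exact h.orthonormal (j + 1) (by lia)

theorem tendsto_coeff {j : ℕ} (hj : j ≤ r + 1) (i : ℕ) :
    Tendsto (fun n => (-1) ^ n * (s n / β n ^ (j + i)) * (P j n).coeff i) atTop
      (𝓝 (besselCoeff (ν + 2 * j) i)) := by
  have he := entireCoeff_besselCoeff (h.order_gt j)
  have hc := tendsto_coeff_of_contConv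
    (P := fun n => C ((-1) ^ n * ((s n / β n ^ j : ℝ) : ℂ)) *
      ((P j n).map (algebraMap ℝ ℂ)).comp (C ((β n : ℂ)⁻¹) * X))
    (g := fun i => powerSum fun m => besselCoeff (ν + 2 * j) (m + i))
    (a := fun i => (besselCoeff (ν + 2 * j) i : ℂ))
    ((h.conv j hj).congr (Eventually.of_forall fun n w => by
      rw [eval_mul, eval_C, eval_comp, eval_map_algebraMap, eval_mul, eval_C, eval_X,
        div_eq_inv_mul w]))
    (fun i => (he.shift i).differentiable_and_deriv.1)
    (fun i w => by
      rw [(he.shift i).powerSum_eq w, zero_add]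
      simp only [add_assoc, add_comm 1 i]) i
  have hre := (Complex.continuous_re.tendsto _).comp hc
  rw [Complex.ofReal_re] at hre
  refine hre.congr fun n => ?_
  simp only [Function.comp_apply, coeff_C_mul, comp_C_mul_X_coeff, coeff_map]
  have e : (-1 : ℂ) ^ n * ((s n / β n ^ j : ℝ) : ℂ) *
      (algebraMap ℝ ℂ ((P j n).coeff i) * ((β n : ℂ)⁻¹) ^ i) =
      (((-1) ^ n * (s n / β n ^ (j + i)) * (P j n).coeff i : ℝ) : ℂ) := by
    rw [Complex.coe_algebraMap]
    push_cast
    rw [pow_add, inv_pow]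
    field_simp
  rw [e, Complex.ofReal_re]

/-- The rescaled polynomials `X^j P j (n - j)` converge locally uniformly. -/
theorem contConv_X_pow_mul {j : ℕ} (hj : j ≤ r + 1) : ContConv
    (fun n w => (-1) ^ n * (s n : ℂ) * aeval (w / (β n : ℂ)) (X ^ j * P j (n - j)))
    (fun w => (-1) ^ j * w ^ j * phi (ν + 2 * j) w) := by
  intro x
  have hρ : Tendsto (fun n => ((β (n - j) / β n : ℝ) : ℂ)) atTop (𝓝 1) := by
    have := (Complex.continuous_ofReal.tendsto 1).comp (h.tendsto_β_ratio j)
    simpa [Function.comp_def] using this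
  have hσ : Tendsto (fun n => ((s n / s (n - j) : ℝ) : ℂ)) atTop (𝓝 1) := by
    have := (Complex.continuous_ofReal.tendsto 1).comp (h.tendsto_s_ratio j)
    simpa [Function.comp_def] using this
  have h1 : Tendsto (fun y : ℕ × ℂ => y.2 * ((β (y.1 - j) / β y.1 : ℝ) : ℂ)) (atTop ×ˢ 𝓝 x)
      (𝓝 x) := by
    have := (tendsto_snd (f := atTop) (g := 𝓝 x)).mul (hρ.comp tendsto_fst)
    rwa [mul_one] at this
  have h2 := (h.conv j hj x).comp
    (((tendsto_sub_atTop_nat j).comp (tendsto_fst (f := atTop) (g := 𝓝 x))).prodMk h1)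
  have h3 := (((tendsto_const_nhds (x := (-1 : ℂ) ^ j)).mul
    ((tendsto_snd (f := atTop) (g := 𝓝 x)).pow j)).mul
    (((hσ.comp (tendsto_fst (f := atTop) (g := 𝓝 x))).mul
      ((hρ.comp (tendsto_fst (f := atTop) (g := 𝓝 x))).pow j)))).mul h2
  rw [one_pow, mul_one, mul_one] at h3
  refine h3.congr' ?_
  have hev : ∀ᶠ n in atTop, j ≤ n ∧ s (n - j) ≠ 0 ∧ 0 < β (n - j) ∧ 0 < β n := by
    filter_upwards [eventually_ge_atTop j, (tendsto_sub_atTop_nat j).eventually h.eventually_s_ne,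
      (tendsto_sub_atTop_nat j).eventually h.eventually_β_pos, h.eventually_β_pos]
      with n a1 a2 a3 a4 using ⟨a1, a2, a3, a4⟩
  filter_upwards [hev.prod_inl (𝓝 x)] with y hy
  obtain ⟨hn, hs0, hb1, hb0⟩ := hy
  simp only [Function.comp_apply]
  have q1 : (s (y.1 - j) : ℂ) ≠ 0 := by exact_mod_cast hs0
  have q2 : (β (y.1 - j) : ℂ) ≠ 0 := by exact_mod_cast hb1.ne'
  have q3 : (β y.1 : ℂ) ≠ 0 := by exact_mod_cast hb0.ne'
  have e1 : y.2 * ((β (y.1 - j) / β y.1 : ℝ) : ℂ) / (β (y.1 - j) : ℂ) = y.2 / (β y.1 : ℂ) := by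
    push_cast
    field_simp
  have e2 : (-1 : ℂ) ^ y.1 = (-1) ^ j * (-1) ^ (y.1 - j) := by
    rw [← pow_add, Nat.add_sub_cancel' hn]
  rw [e1, map_mul, map_pow, aeval_X, e2]
  push_cast
  simp only [div_pow]
  field_simp

theorem tendsto_coeff_X_pow_mul {j : ℕ} (hj : j ≤ r + 1) {i : ℕ} (hji : j ≤ i) :
    Tendsto (fun n => (-1) ^ n * (s n / β n ^ i) * (X ^ j * P j (n - j)).coeff i) atTop
      (𝓝 ((-1) ^ j * besselCoeff (ν + 2 * j) (i - j))) := by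
  have h1 := (((tendsto_const_nhds (x := (-1 : ℝ) ^ j)).mul (h.tendsto_s_ratio j)).mul
    ((h.tendsto_β_ratio j).pow i)).mul
    ((h.tendsto_coeff hj (i - j)).comp (tendsto_sub_atTop_nat j))
  rw [one_pow, mul_one, mul_one] at h1
  refine h1.congr' ?_
  filter_upwards [eventually_ge_atTop j, (tendsto_sub_atTop_nat j).eventually h.eventually_s_ne,
      (tendsto_sub_atTop_nat j).eventually h.eventually_β_pos, h.eventually_β_pos]
      with n hn hs0 hb1 hb0
  have e2 : (-1 : ℝ) ^ n = (-1) ^ j * (-1) ^ (n - j) := by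
    rw [← pow_add, Nat.add_sub_cancel' hn]
  simp only [Function.comp_apply]
  rw [coeff_X_pow_mul', if_pos hji, Nat.add_sub_cancel' hji, e2, div_pow]
  field_simp

theorem leadingCoeff_le {j n : ℕ} (hj : j ≤ r + 1) (hn : j ≤ n) :
    (P j (n - j)).leadingCoeff ≤ (P 0 n).leadingCoeff := by
  induction j with
  | zero => exact le_rfl
  | succ j ih =>
    have h1 := leadingCoeff_christoffel_le (h.nonneg.shift j) (h.orthonormal j (by lia))
      (h.orthonormal_succ (by lia)) (n - (j + 1))
    have e : n - (j + 1) + 1 = n - j := by lia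
    rw [e] at h1
    exact h1.trans (ih (by lia) (by lia))

/-- The zeros of the limit function are positive. -/
theorem phi_zero_pos {w : ℂ} (hw : phi (ν + 2 * (r + 1 : ℕ)) w = 0) : ∃ x : ℝ, 0 < x ∧ w = x := by
  have hlam := h.order_gt (r + 1)
  -- By Hurwitz, `w` is a limit of rescaled zeros of `P (r+1) n`, all of which are positive reals.
  have key : ∀ ε : ℝ, 0 < ε → ∃ y : ℝ, 0 < y ∧ ‖(y : ℂ) - w‖ < ε := by
    intro ε hε
    have h1 := (h.conv (r + 1) le_rfl).exists_zero_near
      (fun n => by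
        have : Differentiable ℂ fun w : ℂ => aeval (w / (β n : ℂ)) (P (r + 1) n) := by
          have d1 : Differentiable ℂ fun w : ℂ => w / (β n : ℂ) := by fun_prop
          have d2 : Differentiable ℂ fun z : ℂ =>
              ((P (r + 1) n).map (algebraMap ℝ ℂ)).eval z := Polynomial.differentiable _
          simp only [← eval_map_algebraMap]
          exact d2.comp d1
        exact this.const_mul _)
      (differentiable_phi hlam) hw (phi_zero_ne_zero hlam) hε
    obtain ⟨n, ⟨z, hz, hz0⟩, hs, hb⟩ := (h1.and (h.eventually_s_ne.and h.eventually_β_pos)).exists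
    have q1 : ((s n / β n ^ (r + 1) : ℝ) : ℂ) ≠ 0 := by
      exact_mod_cast div_ne_zero hs (pow_ne_zero _ hb.ne')
    have hz1 := (mul_eq_zero.1 hz0).resolve_left (mul_ne_zero (by simp) q1)
    obtain ⟨x, hx, hzx⟩ := orthonormal_aeval_root (h.nonneg.shift (r + 1))
      (h.orthonormal (r + 1) le_rfl) hz1
    have q3 : (β n : ℂ) ≠ 0 := by exact_mod_cast hb.ne'
    refine ⟨x * β n, mul_pos hx hb, ?_⟩
    rw [← dist_eq_norm]
    rw [div_eq_iff q3] at hzx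
    push_cast
    rwa [← hzx]
  have him : w.im = 0 := by
    refine abs_eq_zero.1 (le_antisymm (le_of_forall_pos_le_add fun ε hε => ?_) (abs_nonneg _))
    obtain ⟨y, -, hy⟩ := key ε hε
    have := Complex.abs_im_le_norm ((y : ℂ) - w)
    simp only [Complex.sub_im, Complex.ofReal_im, zero_sub, abs_neg] at this
    linarith
  have hre : 0 ≤ w.re := by
    refine le_of_forall_pos_le_add fun ε hε => ?_
    obtain ⟨y, hy0, hy⟩ := key ε hε
    have := (abs_le.1 (Complex.abs_re_le_norm ((y : ℂ) - w))).2
    simp only [Complex.sub_re, Complex.ofReal_re] at this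
    linarith
  have hwx : w = (w.re : ℂ) := Complex.ext rfl (by simpa using him)
  refine ⟨w.re, lt_of_le_of_ne hre fun h0 => ?_, hwx⟩
  rw [hwx, ← h0, Complex.ofReal_zero] at hw
  exact phi_zero_ne_zero hlam hw

/-- The sector bound is iterated from `j` up to `r + 1`. Each step costs six times the ratio of
consecutive terms at `-ρ`; that ratio converges because `phi` has no zeros on the negative axis, so
the constants do not depend on `n`. -/
theorem eventually_sector_chain {ρ : ℝ} (hρ : 0 < ρ) {j : ℕ} (hj : j ≤ r + 1) :
    ∃ D : ℝ, 0 ≤ D ∧ ∀ᶠ n in atTop, ∀ w : ℂ, w.re ≤ |w.im| → ρ ≤ ‖w‖ →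
      ‖aeval (w / (β n : ℂ)) (X ^ j * P j (n - j))‖ ≤
        D * ‖aeval (w / (β n : ℂ)) (X ^ (r + 1) * P (r + 1) (n - (r + 1)))‖ := by
  induction hj using Nat.decreasingInduction with
  | self => exact ⟨1, zero_le_one, Eventually.of_forall fun n w _ _ => by rw [one_mul]⟩
  | of_succ j hj ih =>
    obtain ⟨D, hD, hev⟩ := ih
    set T : ℕ → ℕ → ℂ → ℂ := fun j n w => aeval (w / (β n : ℂ)) (X ^ j * P j (n - j)) with hT
    have hlim : ∀ j ≤ r + 1, ∃ l : ℝ, 0 < l ∧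
        Tendsto (fun n => |s n| * ‖T j n (-ρ : ℂ)‖) atTop (𝓝 l) := by
      intro j hj
      have h1 := ((h.contConv_X_pow_mul hj).tendsto
        (tendsto_const_nhds (x := (-ρ : ℂ)))).norm
      refine ⟨‖(-1 : ℂ) ^ j * (-ρ : ℂ) ^ j * phi (ν + 2 * j) (-ρ : ℂ)‖, norm_pos_iff.2 ?_,
        h1.congr fun n => ?_⟩
      · have h2 := phi_neg_re_pos (h.order_gt j) (x := -ρ) (by linarith)
        have h3 : phi (ν + 2 * j) (-ρ : ℂ) ≠ 0 := fun h0 => by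
          rw [Complex.ofReal_neg, h0, Complex.zero_re] at h2
          exact lt_irrefl _ h2
        have h4 : (-ρ : ℂ) ≠ 0 := neg_ne_zero.2 (by exact_mod_cast hρ.ne')
        exact mul_ne_zero (mul_ne_zero (by simp) (pow_ne_zero _ h4)) h3
      · rw [norm_mul, norm_mul, norm_pow, norm_neg, norm_one, one_pow, one_mul, Complex.norm_real,
          Real.norm_eq_abs]
    obtain ⟨l₀, hl₀, ht₀⟩ := hlim j (by lia)
    obtain ⟨l₁, hl₁, ht₁⟩ := hlim (j + 1) (by lia)
    have hratio : ∀ᶠ n in atTop, 6 * (|s n| * ‖T j n (-ρ : ℂ)‖) <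
        (6 * l₀ / l₁ + 1) * (|s n| * ‖T (j + 1) n (-ρ : ℂ)‖) := by
      refine (ht₀.const_mul 6).eventually_lt (ht₁.const_mul _) ?_
      field_simp
      linarith
    refine ⟨(6 * l₀ / l₁ + 1) * D, by positivity, ?_⟩
    filter_upwards [hev, hratio, h.eventually_s_ne, h.eventually_β_pos, eventually_ge_atTop (j + 1),
      ht₁.eventually_const_lt hl₁] with n h1 h2 hs hb hn h3 w hw hρw
    have hb' : (β n : ℂ) ≠ 0 := by exact_mod_cast hb.ne'
    have hs' : 0 < |s n| := abs_pos.2 hs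
    have h4 : 6 * ‖T j n (-ρ : ℂ)‖ ≤ (6 * l₀ / l₁ + 1) * ‖T (j + 1) n (-ρ : ℂ)‖ := by
      refine le_of_mul_le_mul_left ?_ hs'
      linarith
    have h5 : 0 < ‖T (j + 1) n (-ρ : ℂ)‖ := (pos_iff_pos_of_mul_pos h3).1 hs'
    have hsec := norm_orthonormal_le_sector (h.nonneg.shift j) (h.orthonormal j (by lia))
      (h.orthonormal_succ (by lia)) (n - (j + 1)) (t := w / (β n : ℂ)) (ρ := ρ / β n)
      (by
        rw [Complex.div_ofReal_re, Complex.div_ofReal_im, abs_div, abs_of_pos hb]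
        gcongr) (by positivity)
      (by
        rw [norm_div, Complex.norm_real, Real.norm_eq_abs, abs_of_pos hb]
        gcongr)
    have e : n - (j + 1) + 1 = n - j := by lia
    have e2 : (-((ρ / β n : ℝ) : ℂ)) = (-ρ : ℂ) / (β n : ℂ) := by push_cast; ring
    rw [e, e2] at hsec
    have h6 : ‖T j n w‖ * ‖T (j + 1) n (-ρ : ℂ)‖ ≤ 6 * ‖T j n (-ρ : ℂ)‖ * ‖T (j + 1) n w‖ := by
      have nT : ∀ z : ℂ, ‖T j n z‖ = ‖z / (β n : ℂ)‖ ^ j * ‖aeval (z / (β n : ℂ)) (P j (n - j))‖ := by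
        intro z
        simp only [hT]
        rw [map_mul, map_pow, aeval_X, norm_mul, norm_pow]
      have nT' : ∀ z : ℂ, ‖T (j + 1) n z‖ = ‖z / (β n : ℂ)‖ ^ j * (‖z / (β n : ℂ)‖ *
          ‖aeval (z / (β n : ℂ)) (P (j + 1) (n - (j + 1)))‖) := by
        intro z
        simp only [hT]
        rw [map_mul, map_pow, aeval_X, norm_mul, norm_pow]
        ring
      have nρ : ‖(-ρ : ℂ) / (β n : ℂ)‖ = ρ / β n := by
        rw [norm_div, norm_neg, Complex.norm_real, Complex.norm_real, Real.norm_eq_abs,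
          Real.norm_eq_abs, abs_of_pos hb, abs_of_pos hρ]
      rw [nT, nT, nT', nT', nρ]
      rw [norm_mul] at hsec
      have := mul_le_mul_of_nonneg_left hsec
        (show 0 ≤ ‖w / (β n : ℂ)‖ ^ j * (ρ / β n) ^ j by positivity)
      linarith
    have h7 : ‖T j n w‖ ≤ (6 * l₀ / l₁ + 1) * ‖T (j + 1) n w‖ := by
      refine le_of_mul_le_mul_right (h6.trans ?_) h5
      have := mul_le_mul_of_nonneg_right h4 (norm_nonneg (T (j + 1) n w))
      linarith
    calc ‖T j n w‖ ≤ (6 * l₀ / l₁ + 1) * ‖T (j + 1) n w‖ := h7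
      _ ≤ (6 * l₀ / l₁ + 1) * (D * _) := by
        gcongr
        exact h1 w hw hρw
      _ = _ := by ring

end HardEdgeSystem

/-! ### The Sobolev polynomials: connection coefficients, limit and zero-free sector -/

namespace HardEdgeSystem

variable {L : ℝ[X] →ₗ[ℝ] ℝ} {P : ℕ → ℕ → ℝ[X]} {r : ℕ} {s β : ℕ → ℝ} {A B a b ν : ℝ}
  (h : HardEdgeSystem L P r s β A B a b ν) {m : ℕ → ℝ} {Q : ℕ → ℝ[X]}
  (hQ : IsOrthonormalPolynomials (fun f g => coeffSobolevForm L r m f g) Q)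

/-- The Sobolev polynomial `Q n` with the leading coefficient of `P 0 n`. -/
noncomputable def rescaledSobolev (P : ℕ → ℕ → ℝ[X]) (Q : ℕ → ℝ[X]) (n : ℕ) : ℝ[X] :=
  ((P 0 n).leadingCoeff / (Q n).leadingCoeff) • Q n

include hQ in
theorem form_rescaledSobolev {n : ℕ} {f : ℝ[X]} (hf : f.degree < n) :
    L (rescaledSobolev P Q n * f) =
      -∑ i ∈ Finset.range (r + 1), m i * ((rescaledSobolev P Q n).coeff i * f.coeff i) := by
  have h1 := (hQ.apply_of_degree_lt hf).1
  have h2 : coeffSobolevForm L r m (rescaledSobolev P Q n) f = 0 := by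
    rw [rescaledSobolev, map_smul, LinearMap.smul_apply, h1, smul_zero]
  rw [coeffSobolevForm_apply] at h2
  linarith

include hQ in
theorem degree_rescaledSobolev (n : ℕ) :
    (rescaledSobolev P Q n).degree < ((n + 1 : ℕ) : WithBot ℕ) := by
  refine (degree_smul_le _ _).trans_lt ?_
  rw [hQ.degree_eq]
  exact_mod_cast Nat.lt_succ_self n

include hQ in
theorem coeff_rescaledSobolev (n : ℕ) :
    (rescaledSobolev P Q n).coeff n = (P 0 n).leadingCoeff := by
  rw [rescaledSobolev, coeff_smul, hQ.coeff_self, smul_eq_mul,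
    div_mul_cancel₀ _ (hQ.leadingCoeff_pos n).ne']

include h hQ

/-- Equal leading coefficients make the difference from `P 0 n` of degree below `n`. Its expansion
in the `P 0 k` has coefficients determined by the discrete part alone, since Sobolev orthogonality
trades `L` for the point terms. -/
theorem rescaledSobolev_coeff_eq (l n : ℕ) :
    (rescaledSobolev P Q n).coeff l = (P 0 n).coeff l - ∑ i ∈ Finset.range (r + 1),
      m i * (rescaledSobolev P Q n).coeff i *
        ∑ k ∈ Finset.range n, (P 0 k).coeff l * (P 0 k).coeff i := by
  have hP := h.orthonormal_zero
  have hd : (rescaledSobolev P Q n - P 0 n).degree < (n : WithBot ℕ) := by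
    have h1 := degree_rescaledSobolev (P := P) hQ n
    rw [degree_lt_iff_coeff_zero] at h1 ⊢
    intro k hk
    rw [coeff_sub]
    rcases hk.eq_or_lt with rfl | hk
    · rw [coeff_rescaledSobolev hQ, hP.coeff_self, sub_self]
    · rw [h1 k hk, coeff_eq_zero_of_natDegree_lt (by rw [hP.natDegree_eq]; exact hk), sub_self]
  have h2 := congrArg (fun f => coeff f l) (hP.eq_sum_of_degree_lt hd)
  simp only [coeff_sub, finsetSum_coeff, coeff_smul, smul_eq_mul] at h2
  have h3 : ∀ k ∈ Finset.range n, polyForm L (rescaledSobolev P Q n - P 0 n) (P 0 k) =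
      -∑ i ∈ Finset.range (r + 1), m i * ((rescaledSobolev P Q n).coeff i * (P 0 k).coeff i) := by
    intro k hk
    have hk' := Finset.mem_range.1 hk
    have h4 := hP.orthonormal n k
    simp only [if_neg hk'.ne', polyForm_apply] at h4
    rw [polyForm_apply, sub_mul, map_sub, h4, sub_zero]
    exact form_rescaledSobolev hQ (by rw [hP.degree_eq]; exact_mod_cast hk')
  rw [Finset.sum_congr rfl fun k hk => by rw [h3 k hk]] at h2
  have h5 : ∑ k ∈ Finset.range n, (-∑ i ∈ Finset.range (r + 1),
      m i * ((rescaledSobolev P Q n).coeff i * (P 0 k).coeff i)) * (P 0 k).coeff l =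
      -∑ i ∈ Finset.range (r + 1), m i * (rescaledSobolev P Q n).coeff i *
        ∑ k ∈ Finset.range n, (P 0 k).coeff l * (P 0 k).coeff i := by
    simp only [neg_mul, Finset.sum_neg_distrib, Finset.sum_mul, Finset.mul_sum]
    rw [Finset.sum_comm]
    congr 1
    refine Finset.sum_congr rfl fun i _ => Finset.sum_congr rfl fun k _ => ?_
    ring
  rw [h5] at h2
  linarith

variable (hm : ∀ i ≤ r, 0 < m i)
include hm

theorem tendsto_rescaledSobolev_coeff {i : ℕ} (hi : i ≤ r) :
    Tendsto (fun n => (-1) ^ n * (s n / β n ^ i) * (rescaledSobolev P Q n).coeff i) atTop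
      (𝓝 0) := by
  refine tendsto_scaled_coeff_zero (r := r) (u := fun i n => (P 0 n).coeff i)
    (v := fun i n => (rescaledSobolev P Q n).coeff i) (d := besselCoeff ν) h.A_pos h.B_pos h.b_pos
    h.neg_one_lt h.exponents h.asymp_s h.asymp_β
    (fun i _ => besselCoeff_ne_zero h.neg_one_lt i) (fun i _ => ?_) hm
    (fun l _ n => h.rescaledSobolev_coeff_eq hQ l n) hi
  simpa using h.tendsto_coeff (Nat.zero_le _) i

/-- The connection coefficients: asymptotically only the last one matters. -/
theorem exists_connection : ∃ lam : ℕ → ℕ → ℝ,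
    (∀ n, r + 1 ≤ n → rescaledSobolev P Q n =
      ∑ j ∈ Finset.range (r + 2), lam n j • (X ^ j * P j (n - j))) ∧
    (∀ j ≤ r, Tendsto (fun n => lam n j) atTop (𝓝 0)) ∧
    ∀ᶠ n in atTop, 1 / 2 ≤ |lam n (r + 1)| := by
  have hex : ∀ n, ∃ lam : ℕ → ℝ, r + 1 ≤ n → rescaledSobolev P Q n =
      ∑ j ∈ Finset.range (r + 2), lam j • (X ^ j * P j (n - j)) := by
    intro n
    by_cases hn : r + 1 ≤ n
    · obtain ⟨lam, hlam⟩ := exists_eq_sum_X_pow_mul h.nonneg h.orthonormal hn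
        (degree_rescaledSobolev (P := P) hQ n) (fun f hf => by
          have hc : ∀ i ∈ Finset.range (r + 1), (X ^ (r + 1) * f).coeff i = 0 := fun i hi => by
            rw [coeff_X_pow_mul', if_neg (by simpa using hi)]
          rw [form_rescaledSobolev hQ, Finset.sum_eq_zero, neg_zero]
          · intro i hi
            rw [hc i hi, mul_zero, mul_zero]
          · rw [degree_lt_iff_coeff_zero] at hf ⊢
            intro k hk
            rw [coeff_X_pow_mul', if_pos (by lia), hf _ (by lia)])
      exact ⟨lam, fun _ => hlam⟩
    · exact ⟨0, fun hn' => absurd hn' hn⟩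
  choose lam hlam using hex
  -- The coefficient of order `i` only sees the terms with `j ≤ i`, so the system is triangular with
  -- limiting diagonal entries different from zero; the vanishing of the scaled coefficients passes
  -- to `lam n i`.
  have hzero : ∀ j, j ≤ r → Tendsto (fun n => lam n j) atTop (𝓝 0) := by
    intro j
    induction j using Nat.strong_induction_on with
    | _ i ih =>
      intro hi
      have h1 := h.tendsto_rescaledSobolev_coeff hQ hm hi
      have h2 : Tendsto (fun n => ∑ j ∈ Finset.range i, lam n j *
          ((-1) ^ n * (s n / β n ^ i) * (X ^ j * P j (n - j)).coeff i)) atTop (𝓝 0) := by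
        have : (0 : ℝ) = ∑ j ∈ Finset.range i,
            0 * ((-1) ^ j * besselCoeff (ν + 2 * j) (i - j)) := by simp
        rw [this]
        refine tendsto_finsetSum _ fun j hj => ?_
        have hj' := Finset.mem_range.1 hj
        exact (ih j hj' (by lia)).mul (h.tendsto_coeff_X_pow_mul (by lia) hj'.le)
      have h3 := h.tendsto_coeff_X_pow_mul (show i ≤ r + 1 by lia) (le_refl i)
      have hne : (-1 : ℝ) ^ i * besselCoeff (ν + 2 * i) (i - i) ≠ 0 :=
        mul_ne_zero (by simp) (besselCoeff_ne_zero (h.order_gt i) _)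
      have h4 := (h1.sub h2).div h3 hne
      rw [sub_zero, zero_div] at h4
      refine h4.congr' ?_
      filter_upwards [h3.eventually_ne hne, eventually_ge_atTop (r + 1)] with n hn0 hn
      simp only [Pi.div_apply]
      rw [div_eq_iff hn0]
      have h5 := congrArg (fun f => coeff f i) (hlam n hn)
      simp only [finsetSum_coeff, coeff_smul, smul_eq_mul] at h5
      have h6 : ∑ j ∈ Finset.range (r + 2), lam n j * (X ^ j * P j (n - j)).coeff i =
          ∑ j ∈ Finset.range (i + 1), lam n j * (X ^ j * P j (n - j)).coeff i := by
        refine (Finset.sum_subset (Finset.range_mono (by lia)) fun j _ hj => ?_).symm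
        rw [coeff_X_pow_mul', if_neg (by simpa using hj), mul_zero]
      rw [h5, h6, Finset.sum_range_succ, mul_add, Finset.mul_sum]
      have h7 : ∀ j ∈ Finset.range i, (-1) ^ n * (s n / β n ^ i) *
          (lam n j * (X ^ j * P j (n - j)).coeff i) = lam n j *
          ((-1) ^ n * (s n / β n ^ i) * (X ^ j * P j (n - j)).coeff i) := fun j _ => by ring
      rw [Finset.sum_congr rfl h7]
      ring
  refine ⟨lam, hlam, hzero, ?_⟩
  have hsum : Tendsto (fun n => ∑ j ∈ Finset.range (r + 1), |lam n j|) atTop (𝓝 0) := by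
    have : (0 : ℝ) = ∑ j ∈ Finset.range (r + 1), |(0 : ℝ)| := by simp
    rw [this]
    exact tendsto_finsetSum _ fun j hj =>
      (hzero j (Nat.lt_succ_iff.1 (Finset.mem_range.1 hj))).abs
  filter_upwards [hsum.eventually_lt_const (show (0 : ℝ) < 1 / 2 by norm_num),
    eventually_ge_atTop (r + 1)] with n h1 hn
  have hpos := h.orthonormal_zero.leadingCoeff_pos n
  have h2 := congrArg (fun f => coeff f n) (hlam n hn)
  simp only [finsetSum_coeff, coeff_smul, smul_eq_mul] at h2
  rw [coeff_rescaledSobolev hQ] at h2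
  -- No `P j (n - j)` has a leading coefficient above that of `P 0 n`; comparing coefficients of
  -- degree `n` gives `1 ≤ ∑ |lam n j|`, which the last term must eventually supply.
  have h3 : ∀ j ∈ Finset.range (r + 2), lam n j * (X ^ j * P j (n - j)).coeff n ≤
      |lam n j| * (P 0 n).leadingCoeff := by
    intro j hj
    have hj' := Finset.mem_range.1 hj
    have hPj := h.orthonormal j (by lia)
    rw [coeff_X_pow_mul', if_pos (by lia), hPj.coeff_self]
    have h4 := h.leadingCoeff_le (show j ≤ r + 1 by lia) (show j ≤ n by lia)
    have h5 := hPj.leadingCoeff_pos (n - j)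
    calc _ ≤ |lam n j| * (P j (n - j)).leadingCoeff := by
          gcongr
          exact le_abs_self _
      _ ≤ _ := by gcongr
  have h4 := Finset.sum_le_sum h3
  rw [← h2, ← Finset.sum_mul, Finset.sum_range_succ] at h4
  have h5 : 1 ≤ ∑ j ∈ Finset.range (r + 1), |lam n j| + |lam n (r + 1)| := by
    by_contra hlt
    push Not at hlt
    nlinarith
  linarith

/-- Rescaled at the hard edge, the Sobolev polynomials converge up to constant factors. -/
theorem exists_contConv_sobolev : ∃ K : ℕ → ℂ, (∀ᶠ n in atTop, K n ≠ 0) ∧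
    ContConv (fun n w => K n * aeval (w / (β n : ℂ)) (Q n))
      (fun w => (-1) ^ (r + 1) * w ^ (r + 1) * phi (ν + 2 * (r + 1 : ℕ)) w) := by
  obtain ⟨lam, hlam, hzero, hhalf⟩ := h.exists_connection hQ hm
  have hne : ∀ᶠ n in atTop, lam n (r + 1) ≠ 0 := by
    filter_upwards [hhalf] with n hn h0
    rw [h0, abs_zero] at hn
    norm_num at hn
  have hPpos := h.orthonormal_zero.leadingCoeff_pos
  have hQpos := hQ.leadingCoeff_pos
  refine ⟨fun n => (-1) ^ n * (s n : ℂ) *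
    (((P 0 n).leadingCoeff / (Q n).leadingCoeff / lam n (r + 1) : ℝ) : ℂ), ?_, ?_⟩
  · filter_upwards [hne, h.eventually_s_ne] with n h1 h2
    have h3 : ((P 0 n).leadingCoeff / (Q n).leadingCoeff / lam n (r + 1) : ℝ) ≠ 0 :=
      div_ne_zero (div_ne_zero (hPpos n).ne' (hQpos n).ne') h1
    exact mul_ne_zero (mul_ne_zero (by simp) (by exact_mod_cast h2)) (by exact_mod_cast h3)
  · have hq : ∀ j ≤ r, Tendsto (fun n => ((lam n j / lam n (r + 1) : ℝ) : ℂ)) atTop (𝓝 0) := by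
      intro j hj
      have h1 : Tendsto (fun n => lam n j / lam n (r + 1)) atTop (𝓝 0) := by
        have h2 := (hzero j hj).abs.const_mul 2
        rw [abs_zero, mul_zero] at h2
        refine squeeze_zero_norm' ?_ h2
        filter_upwards [hhalf] with n hn
        rw [Real.norm_eq_abs, abs_div, div_le_iff₀ (by linarith)]
        nlinarith [abs_nonneg (lam n j)]
      have h3 := (Complex.continuous_ofReal.tendsto 0).comp h1
      rwa [Complex.ofReal_zero] at h3
    have hc : ContConv (fun n w => ∑ j ∈ Finset.range (r + 1),
        ((lam n j / lam n (r + 1) : ℝ) : ℂ) *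
          ((-1) ^ n * (s n : ℂ) * aeval (w / (β n : ℂ)) (X ^ j * P j (n - j))) +
        (-1) ^ n * (s n : ℂ) * aeval (w / (β n : ℂ)) (X ^ (r + 1) * P (r + 1) (n - (r + 1))))
        (fun w => (-1) ^ (r + 1) * w ^ (r + 1) * phi (ν + 2 * (r + 1 : ℕ)) w) := by
      intro x
      have h1 : Tendsto (fun y : ℕ × ℂ => ∑ j ∈ Finset.range (r + 1),
          ((lam y.1 j / lam y.1 (r + 1) : ℝ) : ℂ) *
          ((-1) ^ y.1 * (s y.1 : ℂ) * aeval (y.2 / (β y.1 : ℂ)) (X ^ j * P j (y.1 - j))))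
          (atTop ×ˢ 𝓝 x) (𝓝 0) := by
        have : (0 : ℂ) = ∑ j ∈ Finset.range (r + 1),
            0 * ((-1) ^ j * x ^ j * phi (ν + 2 * j) x) := by simp
        rw [this]
        refine tendsto_finsetSum _ fun j hj => ?_
        have hj' := Nat.lt_succ_iff.1 (Finset.mem_range.1 hj)
        exact ((hq j hj').comp tendsto_fst).mul (h.contConv_X_pow_mul (by lia) x)
      have h2 := h1.add (h.contConv_X_pow_mul (le_refl (r + 1)) x)
      rwa [zero_add] at h2
    refine hc.congr ?_
    filter_upwards [hne, eventually_ge_atTop (r + 1)] with n hn0 hn w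
    have h1 := congrArg (aeval (w / (β n : ℂ))) (hlam n hn)
    rw [rescaledSobolev, map_smul, map_sum, Finset.sum_range_succ] at h1
    simp only [map_smul, Complex.real_smul] at h1
    have hn0' : (lam n (r + 1) : ℂ) ≠ 0 := by exact_mod_cast hn0
    have h2 : ∑ j ∈ Finset.range (r + 1), ((lam n j / lam n (r + 1) : ℝ) : ℂ) *
          ((-1) ^ n * (s n : ℂ) * aeval (w / (β n : ℂ)) (X ^ j * P j (n - j))) =
        (-1) ^ n * (s n : ℂ) / lam n (r + 1) * ∑ j ∈ Finset.range (r + 1),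
          (lam n j : ℂ) * aeval (w / (β n : ℂ)) (X ^ j * P j (n - j)) := by
      rw [Finset.mul_sum]
      refine Finset.sum_congr rfl fun j _ => ?_
      push_cast
      field_simp
    have h3 : (-1) ^ n * (s n : ℂ) *
        (((P 0 n).leadingCoeff / (Q n).leadingCoeff / lam n (r + 1) : ℝ) : ℂ) *
          aeval (w / (β n : ℂ)) (Q n) = (-1) ^ n * (s n : ℂ) / lam n (r + 1) *
        ((((P 0 n).leadingCoeff / (Q n).leadingCoeff : ℝ) : ℂ) *
          aeval (w / (β n : ℂ)) (Q n)) := by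
      push_cast
      ring
    rw [h3, h1, h2, mul_add]
    congr 1
    field_simp

/-- For large `n` the rescaled Sobolev polynomial has no zeros in the sector `Re w ≤ |Im w|`
outside a given disc around the origin. -/
theorem eventually_sobolev_ne_zero {ρ : ℝ} (hρ : 0 < ρ) : ∀ᶠ n in atTop, ∀ w : ℂ,
    w.re ≤ |w.im| → ρ ≤ ‖w‖ → aeval (w / (β n : ℂ)) (Q n) ≠ 0 := by
  obtain ⟨lam, hlam, hzero, hhalf⟩ := h.exists_connection hQ hm
  have hch : ∀ j, ∃ D : ℝ, j ≤ r + 1 → 0 ≤ D ∧ ∀ᶠ n in atTop, ∀ w : ℂ, w.re ≤ |w.im| → ρ ≤ ‖w‖ →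
      ‖aeval (w / (β n : ℂ)) (X ^ j * P j (n - j))‖ ≤
        D * ‖aeval (w / (β n : ℂ)) (X ^ (r + 1) * P (r + 1) (n - (r + 1)))‖ := by
    intro j
    by_cases hj : j ≤ r + 1
    · obtain ⟨D, hD⟩ := h.eventually_sector_chain hρ hj
      exact ⟨D, fun _ => hD⟩
    · exact ⟨0, fun hj' => absurd hj' hj⟩
  choose D hD using hch
  have hsum : Tendsto (fun n => ∑ j ∈ Finset.range (r + 1), |lam n j| * D j) atTop (𝓝 0) := by
    have : (0 : ℝ) = ∑ j ∈ Finset.range (r + 1), |(0 : ℝ)| * D j := by simp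
    rw [this]
    exact tendsto_finsetSum _ fun j hj =>
      (hzero j (Nat.lt_succ_iff.1 (Finset.mem_range.1 hj))).abs.mul_const _
  have hall : ∀ᶠ n in atTop, ∀ j ∈ Finset.range (r + 1), ∀ w : ℂ, w.re ≤ |w.im| → ρ ≤ ‖w‖ →
      ‖aeval (w / (β n : ℂ)) (X ^ j * P j (n - j))‖ ≤
        D j * ‖aeval (w / (β n : ℂ)) (X ^ (r + 1) * P (r + 1) (n - (r + 1)))‖ :=
    (Filter.eventually_all_finset _).2 fun j hj =>
      (hD j (by have := Finset.mem_range.1 hj; lia)).2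
  filter_upwards [hsum.eventually_lt_const (show (0 : ℝ) < 1 / 2 by norm_num), hall, hhalf,
    h.eventually_β_pos, eventually_ge_atTop (r + 1)] with n h1 h2 h3 hb hn w hw hρw hw0
  have h4 := congrArg (aeval (w / (β n : ℂ))) (hlam n hn)
  rw [rescaledSobolev, map_smul, hw0, smul_zero, map_sum, Finset.sum_range_succ] at h4
  simp only [map_smul, Complex.real_smul] at h4
  set Y := aeval (w / (β n : ℂ)) (X ^ (r + 1) * P (r + 1) (n - (r + 1))) with hY
  have hb' : (β n : ℂ) ≠ 0 := by exact_mod_cast hb.ne'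
  have hwne : w ≠ 0 := norm_pos_iff.1 (hρ.trans_le hρw)
  -- The dominating term has its zeros at `0` and on the positive axis, outside this part of the
  -- sector. At a zero of `Q n` the other terms would have to cancel it, but their total is below
  -- half its size.
  have hYne : Y ≠ 0 := by
    rw [hY, map_mul, map_pow, aeval_X]
    refine mul_ne_zero (pow_ne_zero _ (div_ne_zero hwne hb')) fun h0 => ?_
    obtain ⟨x, hx, hwx⟩ := orthonormal_aeval_root (h.nonneg.shift (r + 1))
      (h.orthonormal (r + 1) le_rfl) h0
    rw [div_eq_iff hb', ← Complex.ofReal_mul] at hwx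
    rw [hwx, Complex.ofReal_re, Complex.ofReal_im, abs_zero] at hw
    have := mul_pos hx hb
    linarith
  have h5 : (lam n (r + 1) : ℂ) * Y = -∑ j ∈ Finset.range (r + 1),
      (lam n j : ℂ) * aeval (w / (β n : ℂ)) (X ^ j * P j (n - j)) := by
    linear_combination -h4
  have h6 := congrArg norm h5
  rw [norm_mul, norm_neg, Complex.norm_real, Real.norm_eq_abs] at h6
  have h7 : ‖∑ j ∈ Finset.range (r + 1), (lam n j : ℂ) *
      aeval (w / (β n : ℂ)) (X ^ j * P j (n - j))‖ ≤
      (∑ j ∈ Finset.range (r + 1), |lam n j| * D j) * ‖Y‖ := by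
    rw [Finset.sum_mul]
    refine norm_sum_le_of_le _ fun j hj => ?_
    rw [norm_mul, Complex.norm_real, Real.norm_eq_abs, mul_assoc]
    gcongr
    exact h2 j hj w hw hρw
  have hYpos : 0 < ‖Y‖ := norm_pos_iff.2 hYne
  nlinarith

end HardEdgeSystem

/-! ### Zeros of the limit divided out, and convergence of the Sobolev zeros -/

/-- Successive division of `phi` by the linear factors of its zeros. -/
theorem exists_phi_quotients {lam : ℝ} (hlam : -1 < lam) {x : ℕ → ℝ} (hmono : StrictMono x)
    (hx : ∀ i, phi lam (x i) = 0)
    (hall : ∀ w : ℂ, phi lam w = 0 → ∃ i, w = x i) :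
    ∃ E : ℕ → ℂ → ℂ, E 0 = phi lam ∧ (∀ i, Differentiable ℂ (E i)) ∧
      (∀ i w, E i w = (w - x i) * E (i + 1) w) ∧ (∀ i w, E i w = 0 → ∃ l, i ≤ l ∧ w = x l) ∧
      ∀ i, E i 0 ≠ 0 := by
  set E : ℕ → ℂ → ℂ := fun i => Nat.rec (phi lam) (fun i f => dslope f (x i : ℂ)) i with hE
  have hEs : ∀ i, E (i + 1) = dslope (E i) (x i : ℂ) := fun i => rfl
  have hdiff : ∀ i, Differentiable ℂ (E i) := by
    intro i
    induction i with
    | zero => exact differentiable_phi hlam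
    | succ i ih =>
      rw [hEs, ← differentiableOn_univ]
      exact (Complex.differentiableOn_dslope Filter.univ_mem).2 ih.differentiableOn
  have hprod : ∀ i, (∀ l, i ≤ l → E i (x l) = 0) ∧
      ∀ w, phi lam w = (∏ l ∈ Finset.range i, (w - x l)) * E i w := by
    intro i
    induction i with
    | zero => exact ⟨fun l _ => hx l, fun w => by simp [hE]⟩
    | succ i ih =>
      have hrec : ∀ w, E i w = (w - x i) * E (i + 1) w := fun w => by
        have := sub_smul_dslope (E i) (x i : ℂ) w
        rw [ih.1 i le_rfl, sub_zero, smul_eq_mul] at this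
        rw [hEs, this]
      refine ⟨fun l hl => ?_, fun w => ?_⟩
      · have h1 := hrec (x l)
        rw [ih.1 l (by lia)] at h1
        refine (mul_eq_zero.1 h1.symm).resolve_left (sub_ne_zero.2 fun h2 => ?_)
        have h3 : x l = x i := by exact_mod_cast h2
        have := hmono.injective h3
        lia
      · rw [ih.2 w, hrec w, Finset.prod_range_succ]
        ring
  have hrec : ∀ i w, E i w = (w - x i) * E (i + 1) w := fun i w => by
    have := sub_smul_dslope (E i) (x i : ℂ) w
    rw [(hprod i).1 i le_rfl, sub_zero, smul_eq_mul] at this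
    rw [hEs, this]
  refine ⟨E, rfl, hdiff, hrec, fun i w hw => ?_, fun i h0 => ?_⟩
  · have h1 : phi lam w = 0 := by rw [(hprod i).2 w, hw, mul_zero]
    obtain ⟨l, hl⟩ := hall w h1
    refine ⟨l, ?_, hl⟩
    by_contra hlt
    push Not at hlt
    have hd := hasDerivAt_phi hlam w
    -- A zero of the quotient at an already removed `x l` would be a double zero of `phi`,
    -- contradicting simplicity.
    have hfac : phi lam = fun z : ℂ => (z - (x l : ℂ)) *
        ((∏ k ∈ (Finset.range i).erase l, (z - (x k : ℂ))) * E i z) := by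
      funext z
      rw [(hprod i).2 z, ← Finset.mul_prod_erase _ _ (Finset.mem_range.2 hlt), mul_assoc]
    have hg : DifferentiableAt ℂ
        (fun z => (∏ k ∈ (Finset.range i).erase l, (z - (x k : ℂ))) * E i z) w :=
      DifferentiableAt.mul (by fun_prop) (hdiff i w)
    have hd2 := ((hasDerivAt_id w).sub_const (x l : ℂ)).mul hg.hasDerivAt
    have hd3 : HasDerivAt (phi lam) 0 w := by
      rw [hfac]
      refine hd2.congr_deriv ?_
      rw [hw, mul_zero, mul_zero, id, sub_eq_zero.2 hl, zero_mul, add_zero]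
    exact phi_succ_ne_zero_of_phi_eq_zero hlam h1 (neg_eq_zero.1 (hd.unique hd3))
  · refine phi_zero_ne_zero hlam ?_
    rw [(hprod i).2 0, h0, mul_zero]

/-- The zeros of Sobolev polynomials near the hard edge `0`. -/
theorem HardEdgeSystem.tendsto_zeros {L : ℝ[X] →ₗ[ℝ] ℝ} {P : ℕ → ℕ → ℝ[X]} {r : ℕ}
    {s β : ℕ → ℝ} {A B a b ν : ℝ} (h : HardEdgeSystem L P r s β A B a b ν) {m : ℕ → ℝ}
    {Q : ℕ → ℝ[X]} (hQ : IsOrthonormalPolynomials (fun f g => coeffSobolevForm L r m f g) Q)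
    (hm : ∀ i ≤ r, 0 < m i) {ξ : ℕ → ℕ → ℂ} (hξ : ∀ n, IsOrderedZeros (Q n) n (ξ n)) :
    (∀ k, 1 ≤ k → k ≤ r + 1 → Tendsto (fun n => (β n : ℂ) * ξ n k) atTop (𝓝 0)) ∧
    (∀ k, r + 2 ≤ k → ∃ x : ℝ, IsKthPositiveBesselZero (ν + 2 * r + 2) (k - (r + 1)) x ∧
      Tendsto (fun n => (β n : ℂ) * ξ n k) atTop (𝓝 (((x / 2) ^ 2 : ℝ) : ℂ))) := by
  have hlam := h.order_gt (r + 1)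
  obtain ⟨x, hmono, hxpos, hx0, hxall, hkth⟩ := exists_phi_zeros hlam
  obtain ⟨E, hE0, hEd, hErec, hEz, hEne⟩ := exists_phi_quotients hlam hmono hx0 (fun w hw => by
    obtain ⟨y, hy, rfl⟩ := h.phi_zero_pos hw
    obtain ⟨i, hi⟩ := hxall y hy hw
    exact ⟨i, by rw [hi]⟩)
  obtain ⟨K, hK, hconv⟩ := h.exists_contConv_sobolev hQ hm
  -- While `k ≤ r + 1`, only powers of `w` have been divided out; after that, the first `k - (r +
  -- 2)` positive zeros as well.
  set H : ℕ → ℂ → ℂ := fun k w => if k ≤ r + 1 then (-1) ^ (r + 1) * w ^ (r + 2 - k) * E 0 w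
    else (-1) ^ (r + 1) * E (k - (r + 2)) w with hH
  set ζ : ℕ → ℝ := fun k => if k ≤ r + 1 then 0 else x (k - (r + 2)) with hζ
  have hfac : ∀ n w, aeval w (Q n) =
      ((Q n).leadingCoeff : ℂ) * ∏ i ∈ Finset.Icc 1 n, (w - ξ n i) := by
    intro n w
    have hs : ((Q n).map (algebraMap ℝ ℂ)).Splits := IsAlgClosed.splits _
    have h1 := hs.eq_prod_roots
    rw [(hξ n).1] at h1
    rw [← eval_map_algebraMap, h1, eval_mul, eval_C, leadingCoeff_map, Multiset.map_map,
      eval_multiset_prod, Multiset.map_map]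
    congr 1
    simp
  have key : ∀ k, 1 ≤ k → Tendsto (fun n => (β n : ℂ) * ξ n k) atTop (𝓝 (ζ k : ℂ)) := by
    intro k hk
    refine tendsto_ordered_zeros (W := fun n k => (β n : ℂ) * ξ n k)
      (K := fun n => K n * ((Q n).leadingCoeff : ℂ) / (β n : ℂ) ^ n) (H := H) ?_ ?_ ?_ ?_ ?_ ?_ ?_ ?_
      hk
    · have e : H 1 = fun w => (-1) ^ (r + 1) * w ^ (r + 1) * phi (ν + 2 * (r + 1 : ℕ)) w := by
        funext w
        simp only [hH]
        rw [if_pos (by lia), hE0]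
        rfl
      rw [e]
      refine hconv.congr ?_
      filter_upwards [h.eventually_β_pos] with n hb w
      have hb' : (β n : ℂ) ≠ 0 := by exact_mod_cast hb.ne'
      rw [hfac]
      have h1 : ∏ i ∈ Finset.Icc 1 n, (w - (β n : ℂ) * ξ n i) =
          (β n : ℂ) ^ n * ∏ i ∈ Finset.Icc 1 n, (w / (β n : ℂ) - ξ n i) := by
        have h2 : (β n : ℂ) ^ n = ∏ i ∈ Finset.Icc 1 n, (β n : ℂ) := by simp
        rw [h2, ← Finset.prod_mul_distrib]
        refine Finset.prod_congr rfl fun i _ => ?_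
        field_simp
      rw [h1]
      field_simp
    · filter_upwards [hK, h.eventually_β_pos] with n h1 hb
      have hb' : (β n : ℂ) ≠ 0 := by exact_mod_cast hb.ne'
      have hq : ((Q n).leadingCoeff : ℂ) ≠ 0 := by exact_mod_cast (hQ.leadingCoeff_pos n).ne'
      exact div_ne_zero (mul_ne_zero h1 hq) (pow_ne_zero _ hb')
    · filter_upwards [h.eventually_β_pos] with n hb i hi j hj hij
      have := (hξ n).2 hi hj hij
      simp only [Complex.re_ofReal_mul] at this ⊢
      gcongr
    · intro R'
      -- In the sector all zeros eventually lie within the unit disc; outside it `|Im| < Re`, so the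
      -- norm is at most `2 Re`.
      refine ⟨max 1 (2 * R'), ?_⟩
      filter_upwards [h.eventually_sobolev_ne_zero hQ hm one_pos, h.eventually_β_pos] with n h1 hb
        i hi hre
      have hb' : (β n : ℂ) ≠ 0 := by exact_mod_cast hb.ne'
      rcases le_or_gt ((β n : ℂ) * ξ n i).re |((β n : ℂ) * ξ n i).im| with h2 | h2
      · refine le_max_of_le_left ?_
        by_contra h3
        push Not at h3
        refine h1 _ h2 h3.le ?_
        rw [mul_div_cancel_left₀ _ hb', hfac, Finset.prod_eq_zero hi (sub_self _), mul_zero]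
      · refine le_max_of_le_right ?_
        have h3 := Complex.norm_le_abs_re_add_abs_im ((β n : ℂ) * ξ n i)
        have h4 : 0 < ((β n : ℂ) * ξ n i).re := (abs_nonneg _).trans_lt h2
        rw [abs_of_pos h4] at h3
        linarith
    · intro k _
      simp only [hH]
      split_ifs
      · exact (by fun_prop : Differentiable ℂ fun w : ℂ => (-1) ^ (r + 1) * w ^ (r + 2 - k)).mul
          (hEd 0)
      · exact (hEd _).const_mul _
    · intro k _ w
      simp only [hH, hζ]
      rcases lt_trichotomy k (r + 1) with hk1 | hk1 | hk1
      · rw [if_pos (by lia), if_pos (by lia), if_pos (by lia)]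
        have e : r + 2 - k = (r + 2 - (k + 1)) + 1 := by lia
        rw [e, pow_succ, Complex.ofReal_zero]
        ring
      · subst hk1
        rw [if_pos le_rfl, if_pos le_rfl, if_neg (by lia)]
        have e1 : r + 2 - (r + 1) = 1 := by lia
        have e2 : r + 1 + 1 - (r + 2) = 0 := by lia
        rw [e1, e2, Complex.ofReal_zero]
        ring
      · rw [if_neg (by lia), if_neg (by lia), if_neg (by lia), hErec]
        have e : k + 1 - (r + 2) = k - (r + 2) + 1 := by lia
        rw [e]
        ring
    · intro k hk
      by_cases hk1 : k ≤ r + 1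
      · by_contra hcon
        push Not at hcon
        have h1 : ∀ w : ℂ, w ≠ 0 → E 0 w = 0 := by
          intro w hw
          have := hcon w
          simp only [hH, if_pos hk1] at this
          exact (mul_eq_zero.1 this).resolve_left (mul_ne_zero (by simp) (pow_ne_zero _ hw))
        obtain ⟨l, -, hl⟩ := hEz 0 (-1) (h1 _ (by simp))
        have h2 : (-1 : ℝ) = x l := by exact_mod_cast hl
        linarith [hxpos l]
      · refine ⟨0, ?_⟩
        simp only [hH, if_neg hk1]
        exact mul_ne_zero (by simp) (hEne _)
    · intro k _ w hw hre
      simp only [hH, hζ] at hw hre ⊢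
      by_cases hk1 : k ≤ r + 1
      · rw [if_pos hk1] at hw hre ⊢
        rcases mul_eq_zero.1 hw with hw | hw
        · rw [Complex.ofReal_zero]
          exact eq_zero_of_pow_eq_zero ((mul_eq_zero.1 hw).resolve_left (by simp))
        · obtain ⟨l, -, rfl⟩ := hEz 0 w hw
          rw [Complex.ofReal_re] at hre
          linarith [hxpos l]
      · rw [if_neg hk1] at hw hre ⊢
        obtain ⟨l, hl, rfl⟩ := hEz _ w ((mul_eq_zero.1 hw).resolve_left (by simp))
        rw [Complex.ofReal_re] at hre
        rw [le_antisymm hre (hmono.monotone hl)]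
  refine ⟨fun k hk hk1 => ?_, fun k hk => ?_⟩
  · have := key k hk
    simp only [hζ, if_pos hk1] at this
    simpa using this
  · refine ⟨2 * √(x (k - (r + 2))), ?_, ?_⟩
    · have h1 := hkth (k - (r + 2))
      have e1 : k - (r + 2) + 1 = k - (r + 1) := by lia
      have e2 : ν + 2 * ((r + 1 : ℕ) : ℝ) = ν + 2 * r + 2 := by push_cast; ring
      rwa [e1, e2] at h1
    · have h1 := key k (by lia)
      simp only [hζ, if_neg (show ¬k ≤ r + 1 by lia)] at h1
      rwa [mul_div_cancel_left₀ _ two_ne_zero, Real.sq_sqrt (hxpos _).le]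

/-! ### Translation of the edge `c` to the origin -/

theorem integrable_eval {μ : Measure ℝ} (hmom : ∀ k : ℕ, Integrable (fun x : ℝ => x ^ k) μ)
    (f : ℝ[X]) : Integrable (fun x => f.eval x) μ := by
  simp only [eval_eq_sum_range]
  exact integrable_finsetSum _ fun i _ => (hmom i).const_mul _

/-- The functional `f ↦ ∫ f(x - c) dμ(x)`. -/
noncomputable def edgeFunctional (μ : Measure ℝ) (hmom : ∀ k : ℕ, Integrable (fun x : ℝ => x ^ k) μ)
    (c : ℝ) : ℝ[X] →ₗ[ℝ] ℝ where
  toFun f := ∫ x, (taylor (-c) f).eval x ∂μ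
  map_add' f g := by
    simp only [map_add, eval_add]
    exact integral_add (integrable_eval hmom _) (integrable_eval hmom _)
  map_smul' a f := by
    simp only [map_smul, eval_smul, smul_eq_mul, RingHom.id_apply]
    exact integral_const_mul _ _

section

variable {μ : Measure ℝ} (hmom : ∀ k : ℕ, Integrable (fun x : ℝ => x ^ k) μ) (c : ℝ)

theorem edgeFunctional_apply (f : ℝ[X]) :
    edgeFunctional μ hmom c f = ∫ x, f.eval (x - c) ∂μ := by
  change ∫ x, (taylor (-c) f).eval x ∂μ = _
  simp only [taylor_eval, sub_eq_add_neg]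

theorem nonnegFunctional_edgeFunctional (hc : ∀ᵐ x ∂μ, c ≤ x) :
    NonnegFunctional (edgeFunctional μ hmom c) := by
  intro f hf
  rw [edgeFunctional_apply]
  refine integral_nonneg_of_ae ?_
  filter_upwards [hc] with x hx
  exact hf _ (sub_nonneg.2 hx)

theorem polyForm_edgeFunctional_taylor (j : ℕ) (f g : ℝ[X]) :
    polyForm (shiftFunctional (edgeFunctional μ hmom c) j) (taylor c f) (taylor c g) =
      l2Form (christoffel μ c (2 * j)) f g := by
  rw [polyForm_apply, shiftFunctional_apply, edgeFunctional_apply, l2Form, christoffel,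
    integral_withDensity_eq_integral_toReal_smul (by fun_prop)
      (Eventually.of_forall fun x => ENNReal.ofReal_lt_top)]
  refine integral_congr_ae (Eventually.of_forall fun x => ?_)
  have h0 : 0 ≤ (x - c) ^ (2 * j) := by
    rw [pow_mul]
    positivity
  simp only [eval_mul, eval_pow, eval_X, taylor_eval, sub_add_cancel, smul_eq_mul,
    ENNReal.toReal_ofReal h0]

theorem iterate_derivative_eval_eq (f : ℝ[X]) (i : ℕ) :
    (derivative^[i] f).eval c = i.factorial * (taylor c f).coeff i := by
  rw [taylor_coeff, ← factorial_smul_hasseDeriv, LinearMap.smul_apply, eval_smul, nsmul_eq_mul]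

/-- The weights contain `(i!)²` because each of the two `i`th derivatives is `i!` times a Taylor
coefficient at `c`. -/
theorem coeffSobolevForm_taylor (r : ℕ) (M : ℕ → ℝ) (f g : ℝ[X]) :
    coeffSobolevForm (edgeFunctional μ hmom c) r (fun i => M i * (i.factorial : ℝ) ^ 2)
      (taylor c f) (taylor c g) = sobolevForm μ c r M f g := by
  rw [coeffSobolevForm_apply, sobolevForm, edgeFunctional_apply, l2Form]
  congr 1
  · simp only [eval_mul, taylor_eval, sub_add_cancel]
  · refine Finset.sum_congr rfl fun i _ => ?_
    rw [iterate_derivative_eval_eq, iterate_derivative_eval_eq]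
    ring

end

theorem IsOrthonormalPolynomials.taylor {B B' : ℝ[X] → ℝ[X] → ℝ} {p : ℕ → ℝ[X]} (c : ℝ)
    (hp : IsOrthonormalPolynomials B p)
    (hB : ∀ f g, B' (Polynomial.taylor c f) (Polynomial.taylor c g) = B f g) :
    IsOrthonormalPolynomials B' fun n => Polynomial.taylor c (p n) where
  natDegree_eq n := by rw [natDegree_taylor, hp.natDegree_eq]
  leadingCoeff_pos n := by rw [leadingCoeff_taylor]; exact hp.leadingCoeff_pos n
  orthonormal m n := by rw [hB]; exact hp.orthonormal m n

theorem aeval_taylor (c : ℝ) (f : ℝ[X]) (w : ℂ) :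
    aeval w (taylor c f) = aeval ((c : ℂ) + w) f := by
  rw [taylor_apply, aeval_comp, map_add, aeval_X, aeval_C, Complex.coe_algebraMap, add_comm]

theorem IsOrderedZeros.taylor {q : ℝ[X]} {n : ℕ} {ξ : ℕ → ℂ} (h : IsOrderedZeros q n ξ)
    (hq : q ≠ 0) (c : ℝ) :
    IsOrderedZeros (Polynomial.taylor c q) n fun k => ξ k - c := by
  refine ⟨?_, fun i hi j hj hij => ?_⟩
  · have hs : (q.map (algebraMap ℝ ℂ)).Splits := IsAlgClosed.splits _
    have h1 := hs.eq_prod_roots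
    rw [h.1] at h1
    have hlc : (q.map (algebraMap ℝ ℂ)).leadingCoeff ≠ 0 :=
      leadingCoeff_ne_zero.2 ((Polynomial.map_ne_zero_iff (algebraMap ℝ ℂ).injective).2 hq)
    have h2 : (Polynomial.taylor c q).map (algebraMap ℝ ℂ) =
        C (q.map (algebraMap ℝ ℂ)).leadingCoeff *
          (((Finset.Icc 1 n).val.map fun k => ξ k - c).map fun a => X - C a).prod := by
      rw [taylor_apply, Polynomial.map_comp]
      conv_lhs => rw [h1]
      rw [mul_comp, C_comp, multiset_prod_comp]
      simp only [Multiset.map_map, Function.comp_def]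
      congr 2
      refine Multiset.map_congr rfl fun k _ => ?_
      simp
      ring
    rw [h2, roots_C_mul _ hlc, roots_multiset_prod_X_sub_C]
  · have := h.2 hi hj hij
    simp only [Complex.sub_re] at this ⊢
    linarith

/-- Uniform convergence in the variable `z` with `w = z ^ 2`. -/
theorem contConv_of_sq {F : ℕ → ℂ → ℂ} {lam : ℝ} (hlam : -1 < lam)
    (hF : ∀ K : Set ℂ, IsCompact K →
      TendstoUniformlyOn (fun n z => F n (z ^ 2)) (besselEntire lam) atTop K) :
    ContConv F (phi lam) := by
  rw [contConv_iff_tendstoLocallyUniformly (differentiable_phi hlam).continuous,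
    ← tendstoLocallyUniformlyOn_univ,
    tendstoLocallyUniformlyOn_iff_forall_isCompact isOpen_univ]
  intro K _ hK
  obtain ⟨R, hR⟩ := hK.isBounded.subset_closedBall 0
  -- An arbitrary, possibly discontinuous, square root suffices: uniform convergence is only pulled
  -- back along it, and it maps bounded sets to bounded sets.
  have hsqrt : ∀ w : ℂ, ∃ z : ℂ, z ^ 2 = w := fun w =>
    IsAlgClosed.exists_pow_nat_eq w two_pos
  choose g hg using hsqrt
  have h1 := (hF (Metric.closedBall 0 (|R| + 1)) (isCompact_closedBall _ _)).comp g
  have h2 : K ⊆ g ⁻¹' Metric.closedBall 0 (|R| + 1) := by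
    intro w hw
    have h3 := hR hw
    rw [mem_closedBall_zero_iff] at h3
    rw [Set.mem_preimage, mem_closedBall_zero_iff]
    have h4 : ‖g w‖ ^ 2 = ‖w‖ := by rw [← norm_pow, hg]
    nlinarith [le_abs_self R, norm_nonneg (g w), abs_nonneg R]
  refine ((h1.mono h2).congr (Eventually.of_forall fun n w _ => ?_)).congr_right fun w _ => ?_
  · simp only [Function.comp_apply, hg]
  · simp only [Function.comp_apply, besselEntire_eq_phi, hg]

end SobolevOP

theorem mainTheorem11
    (μ : Measure ℝ) [IsFiniteMeasure μ]
    (hmom : ∀ k : ℕ, Integrable (fun x : ℝ => x ^ k) μ)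
    (hinf : μ.support.Infinite)
    (I : Set ℝ) (hI : I.OrdConnected) (hμI : μ Iᶜ = 0)
    (c : ℝ) (hc : IsGLB I c)
    (r : ℕ) (M : ℕ → ℝ) (hM : ∀ i ≤ r, 0 < M i)
    -- `p j n` is the orthonormal polynomial of degree `n` for `(x - c)^(2 j) dμ`
    (p : ℕ → ℕ → ℝ[X])
    (hp : ∀ j ≤ r + 1, SobolevOP.IsOrthonormalPolynomials
      (SobolevOP.l2Form (SobolevOP.christoffel μ c (2 * j))) (p j))
    (q : ℕ → ℝ[X])
    (hq : SobolevOP.IsOrthonormalPolynomials (SobolevOP.sobolevForm μ c r M) q)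
    (α β : ℕ → ℝ) (A B a b ν : ℝ)
    (hA : 0 < A) (hB : 0 < B) (hb : 0 < b) (hν : -1 < ν)
    (hα : SobolevOP.AsympEq (fun n => (Real.sqrt (α n))⁻¹) (fun n => A * (n : ℝ) ^ a))
    (hβ : SobolevOP.AsympEq β (fun n => B * (n : ℝ) ^ b))
    (hab : 2 * a + 1 = b * (ν + 1))
    (hMH : ∀ j ≤ r + 1, ∀ K : Set ℂ, IsCompact K →
      TendstoUniformlyOn
        (fun (n : ℕ) (z : ℂ) =>
          (-1) ^ n * ((Real.sqrt (α n) / β n ^ j : ℝ) : ℂ) *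
            aeval ((c : ℂ) + z ^ 2 / (β n : ℂ)) (p j n))
        (SobolevOP.besselEntire (ν + 2 * j)) atTop K)
    (ξ : ℕ → ℕ → ℂ) (hξ : ∀ n, SobolevOP.IsOrderedZeros (q n) n (ξ n)) :
    (∀ k, 1 ≤ k → k ≤ r + 1 →
      Tendsto (fun n => (β n : ℂ) * (ξ n k - (c : ℂ))) atTop (𝓝 0)) ∧
    (∀ k, r + 2 ≤ k → ∃ x : ℝ,
      SobolevOP.IsKthPositiveBesselZero (ν + 2 * r + 2) (k - (r + 1)) x ∧
      Tendsto (fun n => (β n : ℂ) * (ξ n k - (c : ℂ))) atTop (𝓝 (((x / 2) ^ 2 : ℝ) : ℂ))) := by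
  have hcae : ∀ᵐ x ∂μ, c ≤ x := by
    have hI' : ∀ᵐ x ∂μ, x ∈ I := mem_ae_iff.2 hμI
    filter_upwards [hI'] with x hx using hc.1 hx
  have hsys : SobolevOP.HardEdgeSystem (SobolevOP.edgeFunctional μ hmom c)
      (fun j n => taylor c (p j n)) r (fun n => Real.sqrt (α n)) β A B a b ν :=
    { nonneg := SobolevOP.nonnegFunctional_edgeFunctional hmom c hcae
      orthonormal := fun j hj =>
        (hp j hj).taylor c (SobolevOP.polyForm_edgeFunctional_taylor hmom c j)
      A_pos := hA
      B_pos := hB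
      b_pos := hb
      neg_one_lt := hν
      exponents := hab
      asymp_s := hα
      asymp_β := hβ
      conv := fun j hj => SobolevOP.contConv_of_sq
        (by have : (0 : ℝ) ≤ j := j.cast_nonneg
            linarith)
        (fun K hK => by
          simp only [SobolevOP.aeval_taylor]
          exact hMH j hj K hK) }
  exact hsys.tendsto_zeros (hq.taylor c (SobolevOP.coeffSobolevForm_taylor hmom c r M))
    (fun i hi => mul_pos (hM i hi) (by positivity))
    (fun n => (hξ n).taylor (leadingCoeff_ne_zero.1 (hq.leadingCoeff_pos n).ne') c)
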